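/- A \emph{cube complex} is a (Hausdorff) CW-complex whose cells are cubes of finite dimension glued along their faces by isometries: the restriction of the characteristic map of an $(n+1)$-cube to any codimension-one face is the characteristic map of an $n$-cube, up to an isometry of the cube. (A cube is allowed to be glued to itself along distinct faces, and the vertices of a cube need not be distinct.) The \emph{link} of a vertex $v$ has as vertices the oriented edges starting at $v$, and each corner at $v$ of an $(n+1)$-cube contributes an $n$-simplex spanned by the edges of the cube starting at this corner. Two oriented edges starting at $v$ \emph{span a square} if they are the two sides of a square starting at one of its corners. The complex is \emph{nonpositively curved} if every link is a simplicial flag complex: the vertices of each simplex are distinct, a simplex is determined by its set of vertices, and any nonempty finite set of pairwise adjacent vertices spans a simplex. A \emph{hyperplane} (resp. \emph{oriented hyperplane}) is a class of edges (resp. oriented edges) for the equivalence relation generated by identifying two edges which are parallel sides of a square (resp. parallel and oriented in the same direction). Two hyperplanes $J,H$ are \emph{transverse} if some edges dual to $J$ and $H$ are non-parallel sides of a square. A nonpositively curved cube complex is \emph{special} if (1) no oriented edge $\vec e$ is dual to the same oriented hyperplane as its opposite $-\vec e$ (hyperplanes are two-sided); (2) no two edges dual to the same hyperplane are non-parallel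 sides of a square (no self-intersection); (3) two distinct oriented edges which are dual to the same oriented hyperplane and which have the same initial vertex (resp. the same terminal vertex) span a square (resp. their opposites span a square) (no self-osculation); (4) if $J\neq H$ are transverse hyperplanes, then any two oriented edges dual to $J$ and $H$ respectively (with any orientations) with the same initial vertex span a square (no inter-osculation). The universal cover $p:\widetilde X\to X$ of a connected cube complex is endowed with the lifted cube complex structure. For $n\ge 1$, an \emph{$n$-dimensional combinatorial flat} in $\widetilde X$ is a combinatorial embedding $\mathbb{R}^n\hookrightarrow\widetilde X$, i.e. an injective continuous map sending each cube $z+[0,1]^n$, $z\in\mathbb{Z}^n$, isometrically onto an $n$-cube of $\widetilde X$. \textbf{Theorem.} Let $X$ be a compact connected special cube complex. If the universal cover of $X$ contains an $n$-dimensional combinatorial flat for some $n\geq 1$, then, for every basepoint $x\in X$, the fundamental group $\pi_1(X,x)$ contains a subgroup isomorphic to $\mathbb{Z}^n$. -/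

import Mathlib

open Set Topology

/-! ## Cube complexes

We use Mathlib's CW complexes.  The characteristic map of an `n`-cell is defined on the closed
unit ball of `Fin n → ℝ` for the sup norm, that is, on the cube `[-1,1]ⁿ`. -/

noncomputable section

namespace CubeCpx

/-- A sign `±1`, as a real number. -/
def sgn (ε : ℤˣ) : ℝ := ((ε : ℤ) : ℝ)

/-- The isometry of the cube `[-1,1]ⁿ` that permutes the coordinates by `σ` and multiplies them by
the signs `s`.  Every isometry of the cube is of this form. -/
def cubeIso {n : ℕ} (σ : Equiv.Perm (Fin n)) (s : Fin n → ℤˣ) (t : Fin n → ℝ) : Fin n → ℝ :=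
  fun k => sgn (s k) * t (σ k)

variable (X : Type*) [TopologicalSpace X] [CWComplex (univ : Set X)]

/-- The `n`-cubes (the `n`-cells) of `X`. -/
abbrev Cube (n : ℕ) := RelCWComplex.cell (univ : Set X) n

/-- The closed unit ball for the sup norm: the cube `[-1,1]ⁿ`. -/
abbrev stdCube (n : ℕ) : Set (Fin n → ℝ) := Metric.closedBall 0 1

variable {X}

/-- The characteristic map `[-1,1]ⁿ → X` of an `n`-cube. -/
abbrev charMap {n : ℕ} (c : Cube X n) : (Fin n → ℝ) → X :=
  RelCWComplex.map (C := (univ : Set X)) n c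

/-- `g : [-1,1]ⁿ → X` is the characteristic map of an `n`-cube of `X`, up to an isometry of
`[-1,1]ⁿ`. -/
def ParametrizesCube {n : ℕ} (g : (Fin n → ℝ) → X) : Prop :=
  ∃ (c : Cube X n) (σ : Equiv.Perm (Fin n)) (s : Fin n → ℤˣ),
    ∀ t ∈ stdCube n, g t = charMap c (cubeIso σ s t)

variable (X) in
/-- A CW complex is a cube complex if the cells are cubes glued along their faces by isometries:
the restriction of the characteristic map of an `(n+1)`-cube to each of its codimension-one faces
`{t | t i = ε}` is the characteristic map of an `n`-cube, up to an isometry of `[-1,1]ⁿ`. -/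
def IsCubeComplex : Prop :=
  ∀ (n : ℕ) (c : Cube X (n + 1)) (i : Fin (n + 1)) (ε : ℤˣ),
    ParametrizesCube fun t : Fin n → ℝ => charMap c (i.insertNth (sgn ε) t)

/-! ### Oriented edges and corners of cubes -/

variable (X) in
/-- An oriented edge: a `1`-cube together with one of its two directions. -/
@[ext]
structure OEdge where
  /-- the underlying edge -/
  edge : Cube X 1
  /-- the direction -/
  dir : ℤˣ

namespace OEdge

/-- The parametrization of an oriented edge by `[-1,1]`. -/
def param (a : OEdge X) (t : ℝ) : X := charMap a.edge fun _ => sgn a.dir * t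

/-- The initial vertex. -/
def origin (a : OEdge X) : X := a.param (-1)

/-- The terminal vertex. -/
def terminus (a : OEdge X) : X := a.param 1

/-- The same edge with the opposite orientation. -/
def rev (a : OEdge X) : OEdge X := ⟨a.edge, -a.dir⟩

end OEdge

/-- The vertex of the cube `[-1,1]ⁿ` with coordinates `δ`. -/
def vertex {n : ℕ} (δ : Fin n → ℤˣ) : Fin n → ℝ := fun j => sgn (δ j)

/-- `a` is the oriented edge of the cube `c` which starts at the corner `δ` of `c` and which is
parallel to the `i`-th coordinate axis. -/
def IsCornerEdge {n : ℕ} (c : Cube X n) (δ : Fin n → ℤˣ) (i : Fin n) (a : OEdge X) : Prop :=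
  ∀ t ∈ Icc (-1 : ℝ) 1, charMap c (Function.update (vertex δ) i (-sgn (δ i) * t)) = a.param t

/-- The set of the oriented edges starting at the corner `δ` of the cube `c`: the vertices of the
simplex which this corner contributes to the link of the vertex `charMap c (vertex δ)`. -/
def cornerEdges {n : ℕ} (c : Cube X n) (δ : Fin n → ℤˣ) : Set (OEdge X) :=
  {a | ∃ i, IsCornerEdge c δ i a}

/-- The oriented edges `a` and `b` are the two (non-parallel) sides of some square which start at
some corner of this square. -/
def SpanSquare (a b : OEdge X) : Prop :=
  ∃ (q : Cube X 2) (δ : Fin 2 → ℤˣ) (i j : Fin 2),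
    i ≠ j ∧ IsCornerEdge q δ i a ∧ IsCornerEdge q δ j b

variable (X) in
/-- The link of every vertex is a simplicial flag complex.  The vertices of the link of `v` are the
oriented edges starting at `v`, and its `n`-simplices are the corners at `v` of `(n+1)`-cubes. -/
structure IsNonpositivelyCurved : Prop where
  /-- the vertices of a simplex of a link are pairwise distinct -/
  embedded : ∀ (n : ℕ) (c : Cube X n) (δ : Fin n → ℤˣ) (i j : Fin n) (a : OEdge X),
    IsCornerEdge c δ i a → IsCornerEdge c δ j a → i = j
  /-- a simplex of a link is determined by its vertices -/
  determined : ∀ (n : ℕ) (c c' : Cube X (n + 1)) (δ δ' : Fin (n + 1) → ℤˣ),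
    cornerEdges c δ = cornerEdges c' δ' → c = c' ∧ δ = δ'
  /-- pairwise adjacent vertices of a link span a simplex -/
  flag : ∀ (n : ℕ) (a : Fin (n + 1) → OEdge X), Function.Injective a →
    (∀ i j, (a i).origin = (a j).origin) → (∀ i j, i ≠ j → SpanSquare (a i) (a j)) →
    ∃ (c : Cube X (n + 1)) (δ : Fin (n + 1) → ℤˣ), cornerEdges c δ = range a

/-! ### Hyperplanes -/

/-- The oriented edges `a` and `b` are parallel sides of some square, oriented in the same
direction. -/
def ParallelInSquare (a b : OEdge X) : Prop :=
  ∃ (q : Cube X 2) (δ : Fin 2 → ℤˣ) (i j : Fin 2), i ≠ j ∧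
    IsCornerEdge q δ i a ∧ IsCornerEdge q (Function.update δ j (-δ j)) i b

variable (X) in
/-- Oriented hyperplanes: the classes of oriented edges for the equivalence relation generated by
being parallel sides of a square. -/
def OHyperplane := Quot (ParallelInSquare (X := X))

variable (X) in
/-- Hyperplanes: the classes of edges for the equivalence relation generated by being parallel sides
of a square. -/
def Hyperplane :=
  Quot fun e f : Cube X 1 => ∃ s s' : ℤˣ, ParallelInSquare (X := X) ⟨e, s⟩ ⟨f, s'⟩

/-- The oriented hyperplane dual to an oriented edge. -/
def OEdge.ohyp (a : OEdge X) : OHyperplane X := Quot.mk _ a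

/-- The hyperplane dual to the edge underlying an oriented edge. -/
def OEdge.hyp (a : OEdge X) : Hyperplane X := Quot.mk _ a.edge

/-- Two edges dual to `J` and `H` respectively are non-parallel sides of some square. -/
def Transverse (J H : Hyperplane X) : Prop :=
  ∃ a b : OEdge X, a.hyp = J ∧ b.hyp = H ∧ SpanSquare a b

/-- Two edges dual to `J` are non-parallel sides of some square. -/
def SelfIntersecting (J : Hyperplane X) : Prop :=
  ∃ a b : OEdge X, a.hyp = J ∧ b.hyp = J ∧ SpanSquare a b

/-- Two distinct oriented edges dual to the oriented hyperplane `J` have the same initial vertex,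
or the same terminal vertex, and do not span a square there. -/
def SelfOsculating (J : OHyperplane X) : Prop :=
  ∃ a b : OEdge X, a ≠ b ∧ a.ohyp = J ∧ b.ohyp = J ∧
    ((a.origin = b.origin ∧ ¬ SpanSquare a b) ∨
      (a.terminus = b.terminus ∧ ¬ SpanSquare a.rev b.rev))

/-- `J` and `H` are distinct and transverse, and two edges dual to `J` and `H` respectively start at
the same vertex without spanning a square there. -/
def InterOsculating (J H : Hyperplane X) : Prop :=
  J ≠ H ∧ Transverse J H ∧
    ∃ a b : OEdge X, a.hyp = J ∧ b.hyp = H ∧ a.origin = b.origin ∧ ¬ SpanSquare a b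

variable (X) in
/-- Special cube complexes. -/
structure IsSpecial : Prop where
  isCubeComplex : IsCubeComplex X
  nonpositivelyCurved : IsNonpositivelyCurved X
  twoSided : ∀ a : OEdge X, a.ohyp ≠ a.rev.ohyp
  not_selfIntersecting : ∀ J : Hyperplane X, ¬ SelfIntersecting J
  not_selfOsculating : ∀ J : OHyperplane X, ¬ SelfOsculating J
  not_interOsculating : ∀ J H : Hyperplane X, ¬ InterOsculating J H

/-! ### Combinatorial flats in covers -/

variable {E : Type*} [TopologicalSpace E]

/-- Let `p : E → X` be a covering map, and give `E` the lifted structure of a cube complex, whose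
cubes are the continuous lifts of the characteristic maps of the cubes of `X`.  Then `f` is an
`n`-dimensional combinatorial flat in `E` if it is an injective continuous map `ℝⁿ → E` which
sends each cube `z + [0,1]ⁿ`, with `z ∈ ℤⁿ`, isometrically onto an `n`-cube of `E`; the cube
`z + [0,1]ⁿ` is parametrized by `t ↦ z + (t + 1) / 2`, where `t ∈ [-1,1]ⁿ`. -/
structure IsCombinatorialFlat (p : E → X) (n : ℕ) (f : (Fin n → ℝ) → E) : Prop where
  continuous : Continuous f
  injective : Function.Injective f
  cubes : ∀ z : Fin n → ℤ,
    ParametrizesCube fun t : Fin n → ℝ => p (f fun k => (z k : ℝ) + (t k + 1) / 2)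

end CubeCpx

end

/-! ## Reductions of words which label paths -/

noncomputable section

namespace CubeCpx

/-! Label each oriented edge of the cover `E` by the oriented hyperplane of `X` dual to its image.
Specialness turns labels into a rewriting calculus. Without self-osculation, a vertex and a word
determine at most one path; without inter-osculation, consecutive transverse labels can be exchanged
across a square; two-sidedness and the absence of self-intersection make a label distinct from its
inverse and not transverse to itself. Words thus behave as in a right-angled Artin group.

The geometric input is `coherent_labelledGraph`: in a nonempty closed path of `E`, some edge is
followed by one crossing the same hyperplane of `E` backwards, and all labels in between are
transverse to theirs. Indeed, signed crossings with a hyperplane of `E` form a cocycle, which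
integrates to a map from `E` to the circle; as `E` is simply connected, they sum to zero along
closed paths (`IsCocycle.sum_eq_zero`). Hence each hyperplane is crossed back, and for an innermost
pair every intermediate hyperplane must cross the carrier of the outer one. Consequently labels of
closed paths reduce to the empty word (`Coherent.reds_nil`), and a path is closed once a power of
its label labels a closed path (`Coherent.reads_of_reads_wpow`).

In a flat, the label of an edge depends only on its direction and on its coordinate in that
direction, and labels of different directions are transverse. Since `X` has finitely many edges, the
pigeonhole principle gives in each direction a segment with both ends over one vertex
(`exists_period`); it is not closed, because the flat is injective. The resulting `n` loops commute
since their words do. They are independent: erasing the letters foreign to one direction respects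
reductions (`Reds.filter`), so a relation would make a nonzero power of a single loop trivial, and
then its segment would close up. -/

/-- A graph with oriented edges labelled by `L`, such that edges with the same label and the same
origin coincide, and such that the consecutive labels of a path may be exchanged when they are
transverse. -/
structure LabelledGraph (V L : Type*) where
  /-- there is an edge with a given label between two vertices -/
  Step : V → L → V → Prop
  /-- the label of the opposite edge -/
  inv : L → L
  /-- transversality -/
  T : L → L → Prop
  inv_ne : ∀ a, inv a ≠ a
  T_irrefl : ∀ a, ¬ T a a
  step_inv : ∀ {u a v}, Step u a v → Step v (inv a) u
  step_unique : ∀ {u a v v'}, Step u a v → Step u a v' → v = v'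
  swap : ∀ {u v w a b}, T a b → Step u a v → Step v b w → ∃ v', Step u b v' ∧ Step v' a w

namespace LabelledGraph

variable {V L : Type*} (G : LabelledGraph V L)

/-- There is a path from `u` to `v` labelled by a given word. -/
def Reads (u : V) : List L → V → Prop
  | [], v => u = v
  | a :: w, v => ∃ u', G.Step u a u' ∧ Reads u' w v

/-- Elementary reductions of words. -/
inductive Red : List L → List L → Prop
  | swap (x y : List L) (a b : L) : G.T a b → Red (x ++ a :: b :: y) (x ++ b :: a :: y)
  | cancel (x y : List L) (a : L) : Red (x ++ a :: G.inv a :: y) (x ++ y)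

/-- Reductions of words. -/
def Reds : List L → List L → Prop := Relation.ReflTransGen G.Red

variable {G}

@[simp] theorem reads_nil {u v : V} : G.Reads u [] v ↔ u = v := Iff.rfl

theorem reads_cons {u v : V} {a : L} {w : List L} :
    G.Reads u (a :: w) v ↔ ∃ u', G.Step u a u' ∧ G.Reads u' w v := Iff.rfl

theorem reads_append {u v : V} {w w' : List L} :
    G.Reads u (w ++ w') v ↔ ∃ u', G.Reads u w u' ∧ G.Reads u' w' v := by
  induction w generalizing u with
  | nil => simp
  | cons a w ih =>
    simp only [List.cons_append, reads_cons, ih]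
    exact ⟨fun ⟨b, hb, c, hc, h⟩ => ⟨c, ⟨b, hb, hc⟩, h⟩, fun ⟨c, ⟨b, hb, hc⟩, h⟩ => ⟨b, hb, c, hc, h⟩⟩

theorem reads_unique {u v v' : V} {w : List L} (h : G.Reads u w v) (h' : G.Reads u w v') :
    v = v' := by
  induction w generalizing u with
  | nil => exact h.symm.trans h'
  | cons a w ih =>
    obtain ⟨b, hb, h⟩ := h
    obtain ⟨c, hc, h'⟩ := h'
    obtain rfl := G.step_unique hb hc
    exact ih h h'

theorem reads_inv {u v : V} {w : List L} (h : G.Reads u w v) :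
    G.Reads v (w.reverse.map G.inv) u := by
  induction w generalizing u with
  | nil => exact h.symm
  | cons a w ih =>
    obtain ⟨b, hb, h⟩ := h
    rw [List.reverse_cons, List.map_append, reads_append]
    exact ⟨b, ih h, u, G.step_inv hb, rfl⟩

theorem reads_unique_left {u u' v : V} {w : List L} (h : G.Reads u w v) (h' : G.Reads u' w v) :
    u = u' :=
  reads_unique (reads_inv h) (reads_inv h')

theorem Reads.red {u v : V} {w w' : List L} (h : G.Reads u w v) (hr : G.Red w w') :
    G.Reads u w' v := by
  cases hr with
  | swap x y a b hab =>
    rw [reads_append] at h ⊢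
    obtain ⟨c, hc, d, hd, e, he, h⟩ := h
    obtain ⟨d', h1, h2⟩ := G.swap hab hd he
    exact ⟨c, hc, d', h1, e, h2, h⟩
  | cancel x y a =>
    rw [reads_append] at h ⊢
    obtain ⟨c, hc, d, hd, e, he, h⟩ := h
    obtain rfl := G.step_unique (G.step_inv hd) he
    exact ⟨c, hc, h⟩

theorem Reads.reds {u v : V} {w w' : List L} (h : G.Reads u w v) (hr : G.Reds w w') :
    G.Reads u w' v := by
  induction hr with
  | refl => exact h
  | tail _ hr ih => exact ih.red hr

theorem Red.append_left {w w' : List L} (z : List L) (h : G.Red w w') :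
    G.Red (z ++ w) (z ++ w') := by
  cases h with
  | swap x y a b hab => simpa using Red.swap (z ++ x) y a b hab
  | cancel x y a => simpa using Red.cancel (G := G) (z ++ x) y a

theorem Red.append_right {w w' : List L} (z : List L) (h : G.Red w w') :
    G.Red (w ++ z) (w' ++ z) := by
  cases h with
  | swap x y a b hab => simpa using Red.swap x (y ++ z) a b hab
  | cancel x y a => simpa using Red.cancel (G := G) x (y ++ z) a

theorem Reds.append_left {w w' : List L} (z : List L) (h : G.Reds w w') :
    G.Reds (z ++ w) (z ++ w') := by
  induction h with
  | refl => exact .refl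
  | tail _ hr ih => exact ih.tail (hr.append_left z)

theorem Reds.append_right {w w' : List L} (z : List L) (h : G.Reds w w') :
    G.Reds (w ++ z) (w' ++ z) := by
  induction h with
  | refl => exact .refl
  | tail _ hr ih => exact ih.tail (hr.append_right z)

theorem Reds.append {w w' z z' : List L} (h : G.Reds w w') (h' : G.Reds z z') :
    G.Reds (w ++ z) (w' ++ z') :=
  (h.append_right z).trans (h'.append_left w')

/-- Letters are kept or erased together with their inverses, so each elementary reduction either
survives or becomes trivial. This is the retraction of a right-angled Artin group onto the subgroup
generated by some of its generators. -/
theorem Reds.filter {w w' : List L} (P : L → Bool) (hP : ∀ a, P (G.inv a) = P a)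
    (h : G.Reds w w') : G.Reds (w.filter P) (w'.filter P) := by
  induction h with
  | refl => exact .refl
  | tail _ hr ih =>
    refine ih.trans ?_
    cases hr with
    | swap x y a b hab =>
      by_cases ha : P a <;> by_cases hb : P b <;> simp only [List.filter_append, List.filter_cons,
        ha, hb, if_true, if_false, Bool.false_eq_true]
      · exact .single (.swap _ _ _ _ hab)
      all_goals exact .refl
    | cancel x y a =>
      by_cases ha : P a <;> simp only [List.filter_append, List.filter_cons, hP,
        ha, if_true, if_false, Bool.false_eq_true]
      · exact .single (.cancel _ _ _)
      · exact .refl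

theorem reds_move {a : L} {s : List L} (hs : ∀ k ∈ s, G.T a k) (y : List L) :
    G.Reds (a :: (s ++ y)) (s ++ a :: y) := by
  induction s with
  | nil => exact .refl
  | cons k s ih =>
    have h1 : G.Red (a :: k :: (s ++ y)) (k :: a :: (s ++ y)) :=
      .swap [] _ _ _ (hs k List.mem_cons_self)
    exact (Relation.ReflTransGen.single h1).trans
      ((ih fun k' hk' => hs k' (List.mem_cons_of_mem _ hk')).append_left [k])

theorem reds_comm {x y : List L} (h : ∀ a ∈ x, ∀ b ∈ y, G.T a b) :
    G.Reds (x ++ y) (y ++ x) := by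
  induction x with
  | nil =>
    rw [List.append_nil]
    exact .refl
  | cons a x ih =>
    have h1 := (ih fun a ha => h a (List.mem_cons_of_mem _ ha)).append_left [a]
    have h2 := reds_move (h a List.mem_cons_self) x
    exact h1.trans h2

theorem reds_cancel {a : L} {s : List L} (hs : ∀ k ∈ s, G.T a k) (x y : List L) :
    G.Reds (x ++ a :: (s ++ G.inv a :: y)) (x ++ (s ++ y)) :=
  ((reds_move hs _).append_left x).trans
    (.single (((Red.cancel (G := G) [] y a).append_left s).append_left x))

/-! ### Cancellations in closed paths, and roots of closed paths -/

variable (G) in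
/-- The word contains two letters, inverse to each other, separated by letters which are transverse
to them. -/
def HasCancellation (w : List L) : Prop :=
  ∃ x a s y, w = x ++ a :: (s ++ G.inv a :: y) ∧ ∀ k ∈ s, G.T a k

variable (G) in
/-- Every nonempty closed path contains a cancellation. -/
def Coherent : Prop :=
  ∀ u w, w ≠ [] → G.Reads u w u → G.HasCancellation w

theorem Coherent.reds_nil (hG : G.Coherent) {u : V} {w : List L} (h : G.Reads u w u) :
    G.Reds w [] := by
  induction hn : w.length using Nat.strong_induction_on generalizing w with
  | _ n ih =>
    by_cases hw : w = []
    · subst hw; exact .refl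
    · obtain ⟨x, a, s, y, rfl, hs⟩ := hG u w hw h
      have h1 := reds_cancel hs x y
      refine h1.trans (ih _ ?_ (h.reds h1) rfl)
      simp only [List.length_append, List.length_cons] at hn ⊢
      omega

/-- The powers of a word. -/
def wpow (w : List L) (m : ℕ) : List L := (List.replicate m w).flatten

@[simp] theorem wpow_zero (w : List L) : wpow w 0 = [] := rfl

theorem wpow_succ (w : List L) (m : ℕ) : wpow w (m + 1) = w ++ wpow w m := by
  simp [wpow, List.replicate_succ]

theorem wpow_append_comm (x y : List L) (m : ℕ) :
    x ++ wpow (y ++ x) m = wpow (x ++ y) m ++ x := by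
  induction m with
  | zero => simp
  | succ m ih => simp only [wpow_succ, List.append_assoc, ← ih]

theorem length_wpow (w : List L) (m : ℕ) : (wpow w m).length = m * w.length := by
  induction m with
  | zero => simp
  | succ m ih => rw [wpow_succ, List.length_append, ih]; ring

theorem mem_of_mem_wpow {a : L} {w : List L} {m : ℕ} (h : a ∈ wpow w m) : a ∈ w := by
  simp only [wpow, List.mem_flatten, List.mem_replicate] at h
  obtain ⟨l, ⟨_, rfl⟩, h⟩ := h
  exact h

theorem getElem?_wpow (w : List L) (m k : ℕ) (hk : k < (wpow w m).length) :
    (wpow w m)[k]? = w[k % w.length]? := by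
  induction m generalizing k with
  | zero => simp at hk
  | succ m ih =>
    rw [wpow_succ] at hk ⊢
    by_cases hkw : k < w.length
    · rw [List.getElem?_append_left hkw, Nat.mod_eq_of_lt hkw]
    · push Not at hkw
      rw [List.getElem?_append_right hkw, ih, Nat.mod_eq_sub_mod hkw]
      rw [List.length_append] at hk
      omega

theorem Reds.wpow {w w' : List L} (h : G.Reds w w') (m : ℕ) :
    G.Reds (wpow w m) (wpow w' m) := by
  induction m with
  | zero => exact .refl
  | succ m ih => rw [wpow_succ, wpow_succ]; exact h.append ih

/-- A cancelling pair in a power is less than one period apart, so it is visible in a cyclic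
rotation `y ++ x` of `w`. -/
theorem exists_rotate_of_hasCancellation_wpow {w : List L} {m : ℕ}
    (h : G.HasCancellation (LabelledGraph.wpow w m)) :
    ∃ x y a s t, w = x ++ y ∧ y ++ x = a :: (s ++ G.inv a :: t) ∧ ∀ k ∈ s, G.T a k := by
  obtain ⟨x, a, s, y, hw, hs⟩ := h
  have key := getElem?_wpow w m
  have hlen := congrArg List.length hw
  rw [hw] at key
  simp only [List.length_append, List.length_cons] at key hlen
  have hpos : 0 < w.length := by
    rcases Nat.eq_zero_or_pos w.length with h0 | h0
    · rw [length_wpow, h0] at hlen; omega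
    · exact h0
  have hka := key x.length (by omega)
  rw [List.getElem?_append_right le_rfl] at hka
  simp only [Nat.sub_self, List.getElem?_cons_zero] at hka
  -- Otherwise, by periodicity, `a` recurs at distance `w.length`: either inside `s`, which makes
  -- `a` transverse to itself, or at the place of `G.inv a`.
  have hlt : s.length + 1 < w.length := by
    by_contra hcon
    have h1 := key (x.length + w.length) (by omega)
    rw [Nat.add_mod_right, ← hka, List.getElem?_append_right (by omega)] at h1
    obtain ⟨q, hq⟩ : ∃ q, w.length = q + 1 := ⟨w.length - 1, by omega⟩
    rw [Nat.add_sub_cancel_left, hq, List.getElem?_cons_succ] at h1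
    rcases Nat.lt_or_ge q s.length with h2 | h2
    · rw [List.getElem?_append_left h2] at h1
      exact G.T_irrefl a (hs a (List.mem_of_getElem? h1))
    · rw [List.getElem?_append_right h2] at h1
      have : q - s.length = 0 := by omega
      rw [this, List.getElem?_cons_zero] at h1
      exact G.inv_ne a (Option.some.inj h1)
  have hpre : (a :: (s ++ [G.inv a])) <+: w.rotate (x.length % w.length) := by
    rw [List.prefix_iff_getElem?]
    intro k hk
    simp only [List.length_cons, List.length_append, List.length_nil] at hk
    rw [List.getElem?_rotate (by omega), Nat.add_mod_mod, add_comm k, ← key _ (by omega),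
      List.getElem?_append_right (by omega), Nat.add_sub_cancel_left]
    rw [← List.getElem?_eq_getElem]
    have : a :: (s ++ G.inv a :: y) = (a :: (s ++ [G.inv a])) ++ y := by simp
    rw [this, List.getElem?_append_left (by simpa using hk)]
  obtain ⟨t, ht⟩ := hpre
  refine ⟨w.take (x.length % w.length), w.drop (x.length % w.length), a, s, t,
    (List.take_append_drop _ _).symm, ?_, hs⟩
  rw [← List.rotate_eq_drop_append_take (Nat.mod_lt _ hpos).le, ← ht]
  simp

/-- A path whose label has a power labelling a closed path is closed. -/
theorem Coherent.reads_of_reads_wpow (hG : G.Coherent) {u : V} {w : List L} {m : ℕ}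
    (hm : m ≠ 0) (h : G.Reads u (LabelledGraph.wpow w m) u) : G.Reads u w u := by
  induction hn : w.length using Nat.strong_induction_on generalizing w u with
  | _ n ih =>
    by_cases hw : w = []
    · subst hw; rfl
    obtain ⟨m, rfl⟩ := Nat.exists_eq_succ_of_ne_zero hm
    have hne : LabelledGraph.wpow w (m + 1) ≠ [] := by
      rw [wpow_succ]; simp [hw]
    -- The problem is conjugated by `x`: the rotation `y ++ x`, read from the end `e` of `x`,
    -- reduces to the strictly shorter `s ++ t`, to which the induction applies.
    obtain ⟨x, y, a, s, t, rfl, hyx, hs⟩ :=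
      exists_rotate_of_hasCancellation_wpow (hG u _ hne h)
    have hred : G.Reds (y ++ x) (s ++ t) := by
      rw [hyx]; exact reds_cancel hs [] t
    obtain ⟨e, hxe, -⟩ : ∃ e, G.Reads u x e ∧ True := by
      rw [wpow_succ, List.append_assoc, reads_append] at h
      obtain ⟨e, he, -⟩ := h
      exact ⟨e, he, trivial⟩
    have h1 : G.Reads u (LabelledGraph.wpow (x ++ y) (m + 1) ++ x) e := reads_append.2 ⟨u, h, hxe⟩
    rw [← wpow_append_comm, reads_append] at h1
    obtain ⟨e', he', h1⟩ := h1
    obtain rfl := reads_unique hxe he'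
    have h2 : G.Reads e (s ++ t) e := by
      refine ih _ ?_ (h1.reds (hred.wpow _)) rfl
      have := congrArg List.length hyx
      simp only [List.length_append, List.length_cons] at this hn ⊢
      omega
    -- Read from `e`, the word `y ++ x` ends where its reduction `s ++ t` does, namely at `e`.
    -- Uniqueness of backward reading of `x` then shows that `y` leads from `e` to `u`.
    rw [wpow_succ, reads_append] at h1
    obtain ⟨e2, h3, -⟩ := h1
    obtain rfl := reads_unique (h3.reds hred) h2
    rw [reads_append] at h3 ⊢
    obtain ⟨e3, h4, h5⟩ := h3
    obtain rfl := reads_unique_left hxe h5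
    exact ⟨_, hxe, h4⟩

end LabelledGraph

end CubeCpx

namespace CubeCpx

/-! ## Lifted cubes -/

/-! ### Signs, and the retraction of `ℝⁿ` onto the cube -/

theorem sgn_neg (ε : ℤˣ) : sgn (-ε) = -sgn ε := by simp [sgn]

theorem sgn_mul (ε η : ℤˣ) : sgn (ε * η) = sgn ε * sgn η := by simp [sgn]

@[simp] theorem sgn_one : sgn 1 = 1 := by simp [sgn]

theorem sgn_eq (ε : ℤˣ) : sgn ε = 1 ∨ sgn ε = -1 := by
  rcases Int.units_eq_one_or ε with rfl | rfl
  · exact .inl sgn_one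
  · right; rw [sgn_neg, sgn_one]

theorem sgn_mul_self (ε : ℤˣ) : sgn ε * sgn ε = 1 := by
  rcases sgn_eq ε with h | h <;> rw [h] <;> norm_num

theorem sgn_injective : Function.Injective sgn := by
  intro ε η h
  exact Units.ext (Int.cast_injective h)

theorem mem_stdCube {n : ℕ} {t : Fin n → ℝ} : t ∈ stdCube n ↔ ∀ k, t k ∈ Icc (-1 : ℝ) 1 := by
  rw [stdCube, mem_closedBall_zero_iff, pi_norm_le_iff_of_nonneg zero_le_one]
  simp only [Real.norm_eq_abs, abs_le, mem_Icc]

/-- The projection of the line to `[-1,1]`. -/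
def clamp (x : ℝ) : ℝ := max (-1) (min 1 x)

theorem clamp_mem (x : ℝ) : clamp x ∈ Icc (-1 : ℝ) 1 :=
  ⟨le_max_left _ _, max_le (by norm_num) (min_le_left _ _)⟩

theorem clamp_of_mem {x : ℝ} (h : x ∈ Icc (-1 : ℝ) 1) : clamp x = x := by
  rw [clamp, min_eq_right h.2, max_eq_right h.1]

@[simp] theorem clamp_sgn (ε : ℤˣ) : clamp (sgn ε) = sgn ε := by
  apply clamp_of_mem
  rcases sgn_eq ε with h | h <;> rw [h] <;> norm_num

@[simp] theorem clamp_one : clamp 1 = 1 := clamp_of_mem (by norm_num)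

@[simp] theorem clamp_neg_one : clamp (-1) = -1 := clamp_of_mem (by norm_num)

theorem clamp_neg (x : ℝ) : clamp (-x) = -clamp x := by
  simp only [clamp]
  rcases le_total x 1 with h | h <;> rcases le_total (-1) x with h' | h' <;>
  simp only [min_def, max_def] <;> split_ifs <;> linarith

theorem clamp_sgn_mul (ε : ℤˣ) (x : ℝ) : clamp (sgn ε * x) = sgn ε * clamp x := by
  rcases sgn_eq ε with h | h <;> rw [h]
  · simp
  · simp [clamp_neg]

theorem continuous_clamp : Continuous clamp :=
  continuous_const.max (continuous_const.min continuous_id)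

/-- The projection of `ℝⁿ` to the cube `[-1,1]ⁿ`. -/
def clampMap (n : ℕ) (t : Fin n → ℝ) : Fin n → ℝ := fun k => clamp (t k)

theorem continuous_clampMap (n : ℕ) : Continuous (clampMap n) :=
  continuous_pi fun k => continuous_clamp.comp (continuous_apply k)

theorem clampMap_mem {n : ℕ} (t : Fin n → ℝ) : clampMap n t ∈ stdCube n :=
  mem_stdCube.2 fun k => clamp_mem (t k)

theorem clampMap_of_mem {n : ℕ} {t : Fin n → ℝ} (h : t ∈ stdCube n) : clampMap n t = t :=
  funext fun k => clamp_of_mem (mem_stdCube.1 h k)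

theorem clampMap_cubeIso {n : ℕ} (σ : Equiv.Perm (Fin n)) (s : Fin n → ℤˣ) (t : Fin n → ℝ) :
    clampMap n (cubeIso σ s t) = cubeIso σ s (clampMap n t) :=
  funext fun _ => clamp_sgn_mul _ _

theorem continuous_cubeIso {n : ℕ} (σ : Equiv.Perm (Fin n)) (s : Fin n → ℤˣ) :
    Continuous (cubeIso σ s) :=
  continuous_pi fun k => continuous_const.mul (continuous_apply (σ k))

theorem cubeIso_mem {n : ℕ} (σ : Equiv.Perm (Fin n)) (s : Fin n → ℤˣ) {t : Fin n → ℝ}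
    (h : t ∈ stdCube n) : cubeIso σ s t ∈ stdCube n := by
  rw [← clampMap_of_mem h, ← clampMap_cubeIso]
  exact clampMap_mem _

/-! ### Faces of a cube -/

/-- A map `ℝᵏ → ℝⁿ` which parametrizes a `k`-dimensional face of `[-1,1]ⁿ`. -/
def IsFaceMap {k n : ℕ} (φ : (Fin k → ℝ) → Fin n → ℝ) : Prop :=
  ∃ (ι : Fin k → Fin n) (s : Fin k → ℤˣ), Function.Injective ι ∧
    (∀ a t, φ t (ι a) = sgn (s a) * t a) ∧ ∀ j ∉ range ι, ∃ ε : ℤˣ, ∀ t, φ t j = sgn ε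

theorem IsFaceMap.clampMap_comm {k n : ℕ} {φ : (Fin k → ℝ) → Fin n → ℝ} (h : IsFaceMap φ)
    (t : Fin k → ℝ) : clampMap n (φ t) = φ (clampMap k t) := by
  obtain ⟨ι, s, -, h1, h2⟩ := h
  funext j
  by_cases hj : j ∈ range ι
  · obtain ⟨a, rfl⟩ := hj
    simp only [clampMap, h1, clamp_sgn_mul]
  · obtain ⟨ε, hε⟩ := h2 j hj
    simp only [clampMap, hε, clamp_sgn]

theorem IsFaceMap.continuous {k n : ℕ} {φ : (Fin k → ℝ) → Fin n → ℝ} (h : IsFaceMap φ) :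
    Continuous φ := by
  obtain ⟨ι, s, -, h1, h2⟩ := h
  refine continuous_pi fun j => ?_
  by_cases hj : j ∈ range ι
  · obtain ⟨a, rfl⟩ := hj
    simp only [h1]
    exact continuous_const.mul (continuous_apply a)
  · obtain ⟨ε, hε⟩ := h2 j hj
    simp only [hε]
    exact continuous_const

theorem isFaceMap_cubeIso {n : ℕ} (σ : Equiv.Perm (Fin n)) (s : Fin n → ℤˣ) :
    IsFaceMap (cubeIso σ s) :=
  ⟨σ.symm, fun a => s (σ.symm a), σ.symm.injective, fun a t => by simp [cubeIso],
    fun j hj => absurd ⟨σ j, by simp⟩ hj⟩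

theorem IsFaceMap.cubeIso_comp {k n : ℕ} {φ : (Fin k → ℝ) → Fin n → ℝ} (h : IsFaceMap φ)
    (σ : Equiv.Perm (Fin n)) (r : Fin n → ℤˣ) : IsFaceMap fun t => cubeIso σ r (φ t) := by
  obtain ⟨ι, s, h0, h1, h2⟩ := h
  refine ⟨fun a => σ.symm (ι a), fun a => r (σ.symm (ι a)) * s a,
    σ.symm.injective.comp h0, fun a t => ?_, fun j hj => ?_⟩
  · simp only [cubeIso, Equiv.apply_symm_apply, h1, sgn_mul, mul_assoc]
  · obtain ⟨ε, hε⟩ := h2 (σ j) (by rintro ⟨a, ha⟩; exact hj ⟨a, by simp [ha]⟩)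
    exact ⟨r j * ε, fun t => by simp only [cubeIso, hε, sgn_mul]⟩

/-- The face of `[-1,1]ⁿ` which is the edge through the vertex `δ` in the `i`-th direction. -/
theorem isFaceMap_edge {n : ℕ} (δ : Fin n → ℤˣ) (i : Fin n) :
    IsFaceMap fun t : Fin 1 → ℝ => Function.update (vertex δ) i (t 0) := by
  refine ⟨fun _ => i, fun _ => 1, fun _ _ _ => Subsingleton.elim _ _, fun a t => ?_, fun j hj => ?_⟩
  · rw [Subsingleton.elim a 0]; simp
  · refine ⟨δ j, fun t => ?_⟩
    dsimp only
    rw [Function.update_of_ne]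
    · rfl
    · rintro rfl; exact hj ⟨0, rfl⟩

theorem isFaceMap_square {n : ℕ} (δ : Fin n → ℤˣ) {i j : Fin n} (hij : i ≠ j) :
    IsFaceMap fun t : Fin 2 → ℝ => Function.update (Function.update (vertex δ) i (t 0)) j (t 1) := by
  refine ⟨![i, j], fun _ => 1, ?_, fun a t => ?_, fun k hk => ?_⟩
  · intro a b
    fin_cases a <;> fin_cases b <;> simp [hij, hij.symm]
  · fin_cases a <;> simp [hij]
  · refine ⟨δ k, fun t => ?_⟩
    dsimp only
    rw [Function.update_of_ne, Function.update_of_ne]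
    · rfl
    · rintro rfl; exact hk ⟨0, rfl⟩
    · rintro rfl; exact hk ⟨1, rfl⟩

variable {E : Type*} [TopologicalSpace E]

section

variable {Y : Type*} [TopologicalSpace Y]

theorem lift_unique {q : E → Y} (hp : IsCoveringMap q) {n : ℕ} {ℓ ℓ' : C(Fin n → ℝ, E)}
    (h : ∀ t, q (ℓ t) = q (ℓ' t)) (t₀ : Fin n → ℝ) (h₀ : ℓ t₀ = ℓ' t₀) : ℓ = ℓ' :=
  DFunLike.coe_injective <|
    hp.eq_of_comp_eq ℓ.continuous ℓ'.continuous (funext h) t₀ h₀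

/-- The domain is the whole of `ℝⁿ`, to which the lifting criterion applies directly; this is why
characteristic maps are extended by clamping. -/
theorem exists_lift {q : E → Y} (hp : IsCoveringMap q) {n : ℕ} (g : C(Fin n → ℝ, Y)) (t₀ : Fin n → ℝ) (e : E)
    (he : q e = g t₀) : ∃ ℓ : C(Fin n → ℝ, E), ℓ t₀ = e ∧ ∀ t, q (ℓ t) = g t := by
  obtain ⟨ℓ, ⟨h1, h2⟩, -⟩ := hp.existsUnique_continuousMap_lifts g t₀ e he
  exact ⟨ℓ, h1, congrFun h2⟩

end

variable {X : Type*} [TopologicalSpace X] [CWComplex (univ : Set X)] {p : E → X}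

/-- The characteristic map of a cube, extended to `ℝⁿ`. -/
def cm {n : ℕ} (c : Cube X n) : C(Fin n → ℝ, X) where
  toFun t := charMap c (clampMap n t)
  continuous_toFun := (RelCWComplex.continuousOn n c).comp_continuous (continuous_clampMap n)
    fun t => clampMap_mem t

theorem cm_apply {n : ℕ} (c : Cube X n) (t : Fin n → ℝ) : cm c t = charMap c (clampMap n t) := rfl

theorem cm_of_mem {n : ℕ} (c : Cube X n) {t : Fin n → ℝ} (h : t ∈ stdCube n) :
    cm c t = charMap c t := by rw [cm_apply, clampMap_of_mem h]

/-- The gluing condition concerns codimension one. A face of higher codimension is reached by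
freezing one constant coordinate at a time; when none is left, the face map is an isometry of the
cube. -/
theorem cm_face (hX : IsCubeComplex X) {k n : ℕ} (c : Cube X n) {φ : (Fin k → ℝ) → Fin n → ℝ}
    (h : IsFaceMap φ) : ∃ (c' : Cube X k) (σ : Equiv.Perm (Fin k)) (s : Fin k → ℤˣ),
      ∀ t, cm c (φ t) = cm c' (cubeIso σ s t) := by
  induction n with
  | zero =>
    obtain ⟨ι, s, hι, h1, h2⟩ := h
    have hk : k = 0 := by
      by_contra hk
      exact (ι ⟨0, Nat.pos_of_ne_zero hk⟩).elim0
    subst hk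
    exact ⟨c, 1, 1, fun t => congrArg _ (Subsingleton.elim _ _)⟩
  | succ n ih =>
    have hcl := h.clampMap_comm
    obtain ⟨ι, s, hι, h1, h2⟩ := h
    by_cases hs : Function.Surjective ι
    · have hk : k = n + 1 := by
        simpa using Fintype.card_congr (Equiv.ofBijective ι ⟨hι, hs⟩)
      subst hk
      have hb : Function.Bijective ι := ⟨hι, hs⟩
      refine ⟨c, (Equiv.ofBijective ι hb).symm, fun j => s ((Equiv.ofBijective ι hb).symm j),
        fun t => congrArg _ (funext fun j => ?_)⟩
      obtain ⟨a, rfl⟩ := hs j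
      have : (Equiv.ofBijective ι hb).symm (ι a) = a :=
        (Equiv.ofBijective ι hb).symm_apply_apply a
      simp only [h1, cubeIso, this]
    · rw [Function.Surjective] at hs
      push Not at hs
      obtain ⟨j, hj⟩ := hs
      obtain ⟨ε, hε⟩ := h2 j (by rintro ⟨a, ha⟩; exact hj a ha)
      obtain ⟨c1, σ1, s1, hc1⟩ := hX n c j ε
      choose ι' hι' using fun a => Fin.exists_succAbove_eq (hj a)
      have hφ' : IsFaceMap fun t : Fin k → ℝ => fun i => φ t (j.succAbove i) := by
        refine ⟨ι', s, fun a b hab => hι ?_, fun a t => ?_, fun i hi => ?_⟩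
        · rw [← hι' a, ← hι' b, hab]
        · rw [← h1, ← hι' a]
        · refine h2 _ ?_
          rintro ⟨a, ha⟩
          rw [← hι' a] at ha
          exact hi ⟨a, Fin.succAbove_right_injective ha⟩
      have hφ := fun t => (Fin.insertNth_self_removeNth j (φ t)).symm
      obtain ⟨c2, σ2, s2, hc2⟩ := ih c1 (hφ'.cubeIso_comp σ1 s1)
      refine ⟨c2, σ2, s2, fun t => ?_⟩
      rw [← hc2, cm_apply, hcl, hφ, hε, cm_apply, clampMap_cubeIso]
      have hm : (j.removeNth (φ (clampMap k t))) ∈ stdCube n := by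
        rw [← hcl, mem_stdCube]
        exact fun i => clamp_mem _
      refine (hc1 _ hm).trans ?_
      congr 2
      funext i
      exact (congrFun (hcl t) (j.succAbove i)).symm


/-- `ℓ` is a lift of the characteristic map of a cube, up to an isometry of the cube. -/
def IsLiftedCube (p : E → X) {n : ℕ} (ℓ : C(Fin n → ℝ, E)) : Prop :=
  ∃ (c : Cube X n) (σ : Equiv.Perm (Fin n)) (s : Fin n → ℤˣ), ∀ t, p (ℓ t) = cm c (cubeIso σ s t)

theorem IsLiftedCube.face (hX : IsCubeComplex X) {k n : ℕ} {ℓ : C(Fin n → ℝ, E)}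
    (hℓ : IsLiftedCube p ℓ) {φ : (Fin k → ℝ) → Fin n → ℝ} (hφ : IsFaceMap φ) :
    IsLiftedCube p (ℓ.comp ⟨φ, hφ.continuous⟩) := by
  obtain ⟨c, σ, s, h⟩ := hℓ
  obtain ⟨c', σ', s', h'⟩ := cm_face hX c (hφ.cubeIso_comp σ s)
  exact ⟨c', σ', s', fun t => by rw [← h', ← h]; rfl⟩

theorem exists_liftedCube (hp : IsCoveringMap p) {n : ℕ} (c : Cube X n) (σ : Equiv.Perm (Fin n))
    (s : Fin n → ℤˣ) (t₀ : Fin n → ℝ) (e : E) (he : p e = cm c (cubeIso σ s t₀)) :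
    ∃ ℓ : C(Fin n → ℝ, E), ℓ t₀ = e ∧ (∀ t, p (ℓ t) = cm c (cubeIso σ s t)) :=
  exists_lift hp ((cm c).comp ⟨_, continuous_cubeIso σ s⟩) t₀ e he

/-- Both sides lift the same map and agree at the centre of the cube. -/
theorem IsLiftedCube.clampMap (hp : IsCoveringMap p) {n : ℕ} {ℓ : C(Fin n → ℝ, E)}
    (hℓ : IsLiftedCube p ℓ) (t : Fin n → ℝ) : ℓ (clampMap n t) = ℓ t := by
  obtain ⟨c, σ, s, h⟩ := hℓ
  have := lift_unique hp (ℓ := ℓ.comp ⟨_, continuous_clampMap n⟩) (ℓ' := ℓ) (fun t => ?_) 0 ?_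
  · exact DFunLike.congr_fun this t
  · simp only [ContinuousMap.comp_apply, ContinuousMap.coe_mk, h, cm_apply]
    rw [← clampMap_cubeIso, clampMap_of_mem (clampMap_mem _)]
  · simp only [ContinuousMap.comp_apply, ContinuousMap.coe_mk]
    rw [clampMap_of_mem]
    exact mem_stdCube.2 fun k => by norm_num

/-! ### Lifted edges -/

/-- Open cells are disjoint and characteristic maps are injective on open balls, so an interior
point knows its cube and its coordinates. -/
theorem cm_eq_iff {n m : ℕ} {c : Cube X n} {c' : Cube X m} {t : Fin n → ℝ} {t' : Fin m → ℝ}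
    (ht : t ∈ Metric.ball (0 : Fin n → ℝ) 1) (ht' : t' ∈ Metric.ball (0 : Fin m → ℝ) 1)
    (h : cm c t = cm c' t') :
    (⟨n, c, t⟩ : Σ n, Cube X n × (Fin n → ℝ)) = ⟨m, c', t'⟩ := by
  rw [cm_of_mem c (Metric.ball_subset_closedBall ht),
    cm_of_mem c' (Metric.ball_subset_closedBall ht')] at h
  have hne : (⟨n, c⟩ : Σ n, Cube X n) = ⟨m, c'⟩ := by
    by_contra hne
    exact (RelCWComplex.disjoint_openCell_of_ne hne).ne_of_mem
      (mem_image_of_mem _ ht) (mem_image_of_mem _ ht') h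
  obtain ⟨rfl, hc⟩ := Sigma.mk.inj_iff.1 hne
  obtain rfl := eq_of_heq hc
  have : t = t' := by
    refine (RelCWComplex.map (C := (univ : Set X)) n c).injOn ?_ ?_ h <;> rw [RelCWComplex.source_eq] <;> assumption
  rw [this]

theorem OEdge.param_eq (a : OEdge X) (t : ℝ) :
    a.param (clamp t) = cm a.edge fun _ => sgn a.dir * t := by
  rw [cm_apply, OEdge.param]
  congr 1
  funext k
  exact (clamp_sgn_mul _ _).symm

theorem OEdge.param_of_mem (a : OEdge X) {t : ℝ} (ht : t ∈ Icc (-1 : ℝ) 1) :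
    a.param t = cm a.edge fun _ => sgn a.dir * t := by
  rw [← a.param_eq, clamp_of_mem ht]

theorem OEdge.ext_param {a b : OEdge X} (h : ∀ t ∈ Icc (-1 : ℝ) 1, a.param t = b.param t) :
    a = b := by
  -- The parameter `1 / 2` is interior but off-centre, so it detects the direction as well as the
  -- edge.
  have h1 := h (1 / 2) (by norm_num)
  rw [a.param_of_mem (by norm_num), b.param_of_mem (by norm_num)] at h1
  have hb : ∀ ε : ℤˣ, (fun _ => sgn ε * (1 / 2)) ∈ Metric.ball (0 : Fin 1 → ℝ) 1 := by
    intro ε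
    rw [mem_ball_zero_iff, pi_norm_lt_iff zero_lt_one]
    intro i
    rcases sgn_eq ε with h | h <;> rw [h] <;> norm_num
  have h2 := cm_eq_iff (hb _) (hb _) h1
  simp only [Sigma.mk.inj_iff, heq_eq_eq, Prod.mk.injEq, true_and] at h2
  have h3 := congrFun h2.2 0
  exact OEdge.ext h2.1 (sgn_injective (by linarith))

theorem OEdge.rev_rev (a : OEdge X) : a.rev.rev = a := by simp [OEdge.rev]

theorem OEdge.rev_param (a : OEdge X) (t : ℝ) : a.rev.param t = a.param (-t) := by
  simp [OEdge.rev, OEdge.param, sgn_neg]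

variable (p) in
/-- An oriented edge of the covering space `E`: a lift of an oriented edge of `X`. -/
@[ext]
structure LEdge where
  /-- the parametrization -/
  map : C(Fin 1 → ℝ, E)
  /-- the oriented edge of `X` -/
  base : OEdge X
  /-- the lifting property -/
  lift : ∀ t, p (map t) = base.param (clamp (t 0))

namespace LEdge

/-- The initial vertex. -/
def org (a : LEdge p) : E := a.map fun _ => -1

/-- The terminal vertex. -/
def ter (a : LEdge p) : E := a.map fun _ => 1

/-- The opposite oriented edge. -/
def rev (a : LEdge p) : LEdge p where
  map := a.map.comp ⟨fun t => -t, continuous_neg⟩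
  base := a.base.rev
  lift t := by
    simp only [ContinuousMap.comp_apply, ContinuousMap.coe_mk, a.lift, OEdge.rev_param, Pi.neg_apply,
      clamp_neg]

theorem rev_map (a : LEdge p) (t : Fin 1 → ℝ) : a.rev.map t = a.map (-t) := rfl

theorem rev_org (a : LEdge p) : a.rev.org = a.ter := by
  rw [org, rev_map, ter]; congr 1; funext; simp

theorem rev_ter (a : LEdge p) : a.rev.ter = a.org := rfl

theorem rev_rev (a : LEdge p) : a.rev.rev = a := by
  refine LEdge.ext (ContinuousMap.ext fun t => ?_) a.base.rev_rev
  rw [rev_map, rev_map, neg_neg]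

theorem p_org (a : LEdge p) : p a.org = a.base.origin := by
  rw [org, a.lift, clamp_neg_one]; rfl

theorem p_ter (a : LEdge p) : p a.ter = a.base.terminus := by
  rw [ter, a.lift, clamp_one]; rfl

/-- The projection of the map recovers the base edge. Functions on edges can therefore be defined on
continuous maps, as is done for cocycles. -/
theorem ext_map {a b : LEdge p} (h : a.map = b.map) : a = b := by
  refine LEdge.ext h (OEdge.ext_param fun t ht => ?_)
  have h1 := a.lift fun _ => t
  rw [h, b.lift, clamp_of_mem ht] at h1
  exact h1.symm

theorem ext_org (hp : IsCoveringMap p) {a b : LEdge p} (h : a.base = b.base)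
    (h' : a.org = b.org) : a = b :=
  ext_map (lift_unique hp (fun t => by rw [a.lift, b.lift, h]) _ h')

theorem exists_org (hp : IsCoveringMap p) (a : OEdge X) (e : E) (he : p e = a.origin) :
    ∃ b : LEdge p, b.base = a ∧ b.org = e := by
  obtain ⟨ℓ, h1, h2⟩ := exists_lift hp ((cm a.edge).comp
    ⟨fun t : Fin 1 → ℝ => fun _ : Fin 1 => sgn a.dir * t 0, by fun_prop⟩) (fun _ => -1) e (by
      rw [he, OEdge.origin, a.param_of_mem (by norm_num)]; rfl)
  exact ⟨⟨ℓ, a, fun t => by rw [h2, a.param_eq]; rfl⟩, rfl, h1⟩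

theorem isLiftedCube (a : LEdge p) : IsLiftedCube p a.map := by
  refine ⟨a.base.edge, 1, fun _ => a.base.dir, fun t => ?_⟩
  rw [a.lift, a.base.param_eq]
  congr 1
  funext k
  rw [Subsingleton.elim k 0]
  rfl

theorem exists_map {ℓ : C(Fin 1 → ℝ, E)} (h : IsLiftedCube p ℓ) : ∃ a : LEdge p, a.map = ℓ := by
  obtain ⟨c, σ, s, h⟩ := h
  refine ⟨⟨ℓ, ⟨c, s 0⟩, fun t => ?_⟩, rfl⟩
  rw [h, OEdge.param_eq]
  congr 1
  funext k
  rw [Subsingleton.elim k 0, cubeIso, Subsingleton.elim (σ 0) 0]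

end LEdge

/-! ### Lifted squares -/

/-- `ℓ` is a square with sides `a` and `b` starting at its lower left corner. -/
def IsCorner (ℓ : C(Fin 2 → ℝ, E)) (a b : LEdge p) : Prop :=
  (∀ t, a.map t = ℓ ![t 0, -1]) ∧ ∀ t, b.map t = ℓ ![-1, t 0]

/-- The edges `a` and `b` of `E` are parallel sides of a square, oriented in the same direction. -/
def Par (a b : LEdge p) : Prop :=
  ∃ ℓ : C(Fin 2 → ℝ, E), IsLiftedCube p ℓ ∧ (∀ t, a.map t = ℓ ![t 0, -1]) ∧
    ∀ t, b.map t = ℓ ![t 0, 1]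

/-- The isometry carries the corner `ε` to the one with coordinates `s k * ε (σ k)` and the axis `i`
to `σ.symm i`. The condition `ε i = -1` places the origin of the edge at that corner. -/
theorem isCornerEdge_of_isLiftedCube {ℓ : C(Fin 2 → ℝ, E)} {c : Cube X 2}
    {σ : Equiv.Perm (Fin 2)} {s : Fin 2 → ℤˣ} (h : ∀ t, p (ℓ t) = cm c (cubeIso σ s t))
    {a : LEdge p} (i : Fin 2) (ε : Fin 2 → ℤˣ)
    (ha : ∀ t, a.map t = ℓ (Function.update (vertex ε) i (t 0))) (hε : ε i = -1) :
    IsCornerEdge c (fun k => s k * ε (σ k)) (σ.symm i) a.base := by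
  intro t ht
  have h1 := a.lift fun _ => t
  rw [ha, h, clamp_of_mem ht, cm_of_mem] at h1
  · rw [← h1]
    congr 1
    funext k
    by_cases hk : σ k = i
    · have hk' : k = σ.symm i := by simp [← hk]
      subst hk'
      simp [cubeIso, hε, sgn_neg]
    · have hk' : k ≠ σ.symm i := by rintro rfl; simp at hk
      simp [cubeIso, hk, hk', sgn_mul, vertex]
  · refine cubeIso_mem _ _ (mem_stdCube.2 fun k => ?_)
    by_cases hk : k = i
    · subst hk; simpa using ht
    · rw [Function.update_of_ne hk, vertex]
      rcases sgn_eq (ε k) with h | h <;> rw [h] <;> norm_num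

theorem update_vertex_zero (η : ℤˣ) (x : ℝ) :
    Function.update (vertex ![-1, η]) 0 x = ![x, sgn η] := by
  funext k; fin_cases k <;> simp [vertex]

theorem update_vertex_one (η : ℤˣ) (x : ℝ) :
    Function.update (vertex ![η, -1]) 1 x = ![sgn η, x] := by
  funext k; fin_cases k <;> simp [vertex]

theorem sgn_neg_one : sgn (-1) = -1 := by rw [sgn_neg, sgn_one]

theorem IsCorner.spanSquare {ℓ : C(Fin 2 → ℝ, E)} (hℓ : IsLiftedCube p ℓ) {a b : LEdge p}
    (h : IsCorner ℓ a b) : SpanSquare a.base b.base := by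
  obtain ⟨c, σ, s, hc⟩ := hℓ
  refine ⟨c, fun k => s k * ![-1, -1] (σ k), σ.symm 0, σ.symm 1, by simp, ?_, ?_⟩
  · refine isCornerEdge_of_isLiftedCube hc 0 _ (fun t => ?_) rfl
    rw [update_vertex_zero, h.1, sgn_neg_one]
  · refine isCornerEdge_of_isLiftedCube hc 1 _ (fun t => ?_) rfl
    rw [update_vertex_one, h.2, sgn_neg_one]

theorem Par.parallelInSquare {a b : LEdge p} (h : Par a b) : ParallelInSquare a.base b.base := by
  obtain ⟨ℓ, ⟨c, σ, s, hc⟩, ha, hb⟩ := h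
  refine ⟨c, fun k => s k * ![-1, -1] (σ k), σ.symm 0, σ.symm 1, by simp, ?_, ?_⟩
  · refine isCornerEdge_of_isLiftedCube hc 0 _ (fun t => ?_) rfl
    rw [update_vertex_zero, ha, sgn_neg_one]
  · have h1 := isCornerEdge_of_isLiftedCube hc 0 ![-1, 1] (a := b) (fun t => by
      rw [update_vertex_zero, hb, sgn_one]) rfl
    convert h1 using 1
    funext k
    by_cases hk : σ k = 1
    · have hk' : k = σ.symm 1 := by simp [← hk]
      subst hk'; simp
    · have hk' : k ≠ σ.symm 1 := by rintro rfl; simp at hk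
      have : σ k = 0 := by omega
      simp [hk', this]

theorem exists_isCorner (hp : IsCoveringMap p) {a b : LEdge p} (h : SpanSquare a.base b.base)
    (hab : a.org = b.org) : ∃ ℓ : C(Fin 2 → ℝ, E), IsLiftedCube p ℓ ∧ IsCorner ℓ a b := by
  obtain ⟨c, δ, i, j, hij, ha, hb⟩ := h
  -- With the signs `-δ`, the isometry given by `σ` takes the corner `(-1, -1)` to `δ` and the axes
  -- `0`, `1` to `i`, `j`.
  obtain ⟨σ, hi, hj⟩ : ∃ σ : Equiv.Perm (Fin 2), σ i = 0 ∧ σ j = 1 := by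
    by_cases h0 : i = 0
    · exact ⟨1, h0, by simp; omega⟩
    · exact ⟨Equiv.swap 0 1, by
        rw [show i = 1 by omega]; rfl, by rw [show j = 0 by omega]; rfl⟩
  have hk : ∀ k, k = i ∨ k = j := by omega
  have hA : ∀ t : ℝ, Function.update (vertex δ) i (-sgn (δ i) * t) =
      cubeIso σ (fun k => -δ k) ![t, -1] := by
    intro t; funext k
    rcases hk k with rfl | rfl
    · simp [cubeIso, hi, sgn_neg]
    · simp [cubeIso, hj, hij.symm, sgn_neg, vertex]
  have hB : ∀ t : ℝ, Function.update (vertex δ) j (-sgn (δ j) * t) =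
      cubeIso σ (fun k => -δ k) ![-1, t] := by
    intro t; funext k
    rcases hk k with rfl | rfl
    · simp [cubeIso, hi, hij, sgn_neg, vertex]
    · simp [cubeIso, hj, sgn_neg]
  have hmA : ∀ t : ℝ, ![clamp t, -1] = clampMap 2 ![t, -1] := by
    intro t; funext k; fin_cases k <;> simp [clampMap]
  have hmB : ∀ t : ℝ, ![-1, clamp t] = clampMap 2 ![-1, t] := by
    intro t; funext k; fin_cases k <;> simp [clampMap]
  have ha' : ∀ t, p (a.map t) = cm c (cubeIso σ (fun k => -δ k) ![t 0, -1]) := by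
    intro t
    rw [a.lift, ← ha _ (clamp_mem _), hA, cm_apply, hmA, clampMap_cubeIso]
  have hb' : ∀ t, p (b.map t) = cm c (cubeIso σ (fun k => -δ k) ![-1, t 0]) := by
    intro t
    rw [b.lift, ← hb _ (clamp_mem _), hB, cm_apply, hmB, clampMap_cubeIso]
  obtain ⟨ℓ, h1, h2⟩ := exists_liftedCube hp c σ (fun k => -δ k) ![-1, -1] a.org (ha' _)
  refine ⟨ℓ, ⟨c, σ, _, h2⟩, fun t => ?_, fun t => ?_⟩
  · refine DFunLike.congr_fun (lift_unique hp (ℓ := a.map)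
      (ℓ' := ℓ.comp ⟨fun t : Fin 1 → ℝ => ![t 0, -1], by fun_prop⟩) (fun t => ?_) (fun _ => -1) ?_) t
    · rw [ha', ContinuousMap.comp_apply, h2]; rfl
    · exact h1.symm
  · refine DFunLike.congr_fun (lift_unique hp (ℓ := b.map)
      (ℓ' := ℓ.comp ⟨fun t : Fin 1 → ℝ => ![-1, t 0], by fun_prop⟩) (fun t => ?_) (fun _ => -1) ?_) t
    · rw [hb', ContinuousMap.comp_apply, h2]; rfl
    · exact (h1.trans hab).symm

end CubeCpx

namespace CubeCpx

/-! ## Compact CW complexes are finite -/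

section finite

variable {X : Type*} [TopologicalSpace X] [CWComplex (univ : Set X)]

theorem closedCell_subset_finite_openCells (n : ℕ) (c : Cube X n) :
    ∃ I : Set (Σ n, Cube X n), I.Finite ∧
      RelCWComplex.closedCell n c ⊆ ⋃ x ∈ I, RelCWComplex.openCell x.1 x.2 := by
  induction n using Nat.strong_induction_on with
  | _ n ih =>
    obtain ⟨I, hI⟩ := CWComplex.cellFrontier_subset_finite_closedCell n c
    choose J hJ hJ' using ih
    refine ⟨{⟨n, c⟩} ∪ ⋃ (m : Fin n), ⋃ j ∈ I m, J m m.2 j, (finite_singleton _).union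
      (finite_iUnion fun m => (I m).finite_toSet.biUnion fun j _ => hJ m m.2 j), ?_⟩
    rw [← RelCWComplex.cellFrontier_union_openCell_eq_closedCell]
    refine union_subset (hI.trans ?_) fun x hx => ?_
    · refine iUnion_subset fun m => iUnion_subset fun hm => iUnion₂_subset fun j hj =>
        (hJ' m hm j).trans (iUnion₂_subset fun x hx => ?_)
      refine subset_biUnion_of_mem (u := fun x : Σ n, Cube X n => RelCWComplex.openCell x.1 x.2)
        (.inr (mem_iUnion.2 ⟨⟨m, hm⟩, mem_iUnion₂.2 ⟨j, hj, hx⟩⟩))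
    · exact mem_iUnion₂.2 ⟨⟨n, c⟩, .inl rfl, hx⟩

variable [T2Space X] [CompactSpace X]

-- A closed cell meets finitely many open cells, so every set of cell centres is closed. The centres
-- thus form a closed discrete subset of a compact space.
variable (X) in
theorem finite_cells : Finite (Σ n, Cube X n) := by
  let f : (Σ n, Cube X n) → X := fun x => charMap x.2 0
  have hf : ∀ x, f x ∈ RelCWComplex.openCell x.1 x.2 :=
    fun x => RelCWComplex.map_zero_mem_openCell x.1 x.2
  have hdisj : ∀ x y, f x ∈ RelCWComplex.openCell y.1 y.2 → x = y := fun x y hxy => by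
    by_contra hne
    exact (RelCWComplex.disjoint_openCell_of_ne hne).ne_of_mem (hf x) hxy rfl
  have hinj : Function.Injective f := fun x y hxy => hdisj x y (hxy ▸ hf y)
  have hclosed : ∀ A : Set (Σ n, Cube X n), IsClosed (f '' A) := by
    intro A
    rw [CWComplex.closed (univ : Set X) _ (subset_univ _)]
    intro n c
    obtain ⟨I, hI, hI'⟩ := closedCell_subset_finite_openCells n c
    refine ((hI.image f).subset ?_).isClosed
    rintro _ ⟨⟨x, -, rfl⟩, hx⟩
    obtain ⟨y, hy, hxy⟩ := mem_iUnion₂.1 (hI' hx)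
    rw [hdisj x y hxy]
    exact mem_image_of_mem f hy
  let : TopologicalSpace (Σ n, Cube X n) := ⊥
  have : DiscreteTopology (Σ n, Cube X n) := ⟨rfl⟩
  have hemb : IsClosedEmbedding f :=
    .of_continuous_injective_isClosedMap continuous_of_discreteTopology hinj
      fun A _ => hclosed A
  have := hemb.compactSpace
  exact finite_of_compact_of_discrete

end finite

/-! ## Maps to the circle -/

theorem eq_of_update_invariant {ι α β : Type*} [Fintype ι] [DecidableEq ι] (F : (ι → α) → β)
    (h : ∀ z j a, F (Function.update z j a) = F z) (z z' : ι → α) : F z = F z' := by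
  suffices ∀ S : Finset ι, F (S.piecewise z' z) = F z by
    simpa using (this Finset.univ).symm
  intro S
  induction S using Finset.induction_on with
  | empty => simp
  | insert j S hj ih => rw [Finset.piecewise_insert, h, ih]

theorem coe_eq_zero_of_int {x : ℝ} (m : ℤ) (h : x = m) : (x : AddCircle (1 : ℝ)) = 0 := by
  rw [AddCircle.coe_eq_zero_iff]
  exact ⟨m, by simp [h]⟩

theorem coe_eq_coe_of_int {x y : ℝ} (m : ℤ) (h : x - y = m) :
    (x : AddCircle (1 : ℝ)) = y := by
  rw [← sub_eq_zero, ← AddCircle.coe_sub]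
  exact coe_eq_zero_of_int m h

variable {E : Type*} [TopologicalSpace E]

theorem comp_mk_apply {k n : ℕ} (ℓ : C(Fin n → ℝ, E)) {φ : (Fin k → ℝ) → Fin n → ℝ}
    (h : Continuous φ) (t : Fin k → ℝ) : ℓ.comp ⟨φ, h⟩ t = ℓ (φ t) := rfl

/-- The edge through the vertex `δ` in the `i`-th direction. -/
def edgeMap {n : ℕ} (ℓ : C(Fin n → ℝ, E)) (δ : Fin n → ℤˣ) (i : Fin n) : C(Fin 1 → ℝ, E) :=
  ℓ.comp ⟨_, (isFaceMap_edge δ i).continuous⟩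

theorem edgeMap_apply {n : ℕ} (ℓ : C(Fin n → ℝ, E)) (δ : Fin n → ℤˣ) (i : Fin n)
    (t : Fin 1 → ℝ) : edgeMap ℓ δ i t = ℓ (Function.update (vertex δ) i (t 0)) := rfl

/-- The function on the cube `ℓ` with values in the circle which is affine with slope `χ` in the
direction of every edge. -/
def toCircle (χ : C(Fin 1 → ℝ, E) → ℤ) {n : ℕ} (ℓ : C(Fin n → ℝ, E)) (t : Fin n → ℝ) :
    AddCircle (1 : ℝ) :=
  ∑ i, ((χ (edgeMap ℓ 1 i) * ((clamp (t i) + 1) / 2) : ℝ) : AddCircle (1 : ℝ))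

theorem continuous_toCircle (χ : C(Fin 1 → ℝ, E) → ℤ) {n : ℕ} (ℓ : C(Fin n → ℝ, E)) :
    Continuous (toCircle χ ℓ) := by
  refine continuous_finsetSum _ fun i _ => (AddCircle.continuous_mk' 1).comp ?_
  have := continuous_clamp.comp (continuous_apply (A := fun _ : Fin n => ℝ) i)
  exact continuous_const.mul ((this.add continuous_const).div_const 2)

theorem toCircle_clampMap (χ : C(Fin 1 → ℝ, E) → ℤ) {n : ℕ} (ℓ : C(Fin n → ℝ, E))
    (t : Fin n → ℝ) : toCircle χ ℓ (clampMap n t) = toCircle χ ℓ t := by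
  simp only [toCircle, clampMap, clamp_of_mem (clamp_mem _)]

variable {X : Type*} [TopologicalSpace X] [CWComplex (univ : Set X)] {p : E → X}

/-! ### Cocycles on the edges, and the circle-valued maps integrating them -/

variable (p) in
/-- An integer-valued function on the oriented edges of `E` which changes sign when the orientation
is reversed and takes the same value on parallel sides of squares. -/
structure IsCocycle (χ : C(Fin 1 → ℝ, E) → ℤ) : Prop where
  rev : ∀ a : LEdge p, χ a.rev.map = -χ a.map
  par : ∀ a b : LEdge p, Par a b → χ a.map = χ b.map

namespace IsCocycle

variable {χ : C(Fin 1 → ℝ, E) → ℤ} (hχ : IsCocycle p χ) (hX : IsCubeComplex X)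

include hχ hX

/-- Flipping a coordinate other than `i` moves the edge to the opposite side of a square; flipping
the `i`-th one does not change the edge. -/
theorem edgeMap_update {n : ℕ} {ℓ : C(Fin n → ℝ, E)} (hℓ : IsLiftedCube p ℓ) (δ : Fin n → ℤˣ)
    (i j : Fin n) (ε : ℤˣ) : χ (edgeMap ℓ (Function.update δ j ε) i) = χ (edgeMap ℓ δ i) := by
  by_cases hij : i = j
  · subst hij
    congr 1
    ext t
    simp only [edgeMap_apply]
    congr 1
    funext k
    by_cases hk : k = i
    · subst hk; simp
    · simp [hk, vertex]
  · have key : χ (edgeMap ℓ (Function.update δ j (-1)) i) =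
        χ (edgeMap ℓ (Function.update δ j 1) i) := by
      obtain ⟨a, ha⟩ := LEdge.exists_map
        (hℓ.face hX (isFaceMap_edge (Function.update δ j (-1)) i))
      obtain ⟨b, hb⟩ := LEdge.exists_map
        (hℓ.face hX (isFaceMap_edge (Function.update δ j 1) i))
      have h1 : Par a b := by
        have hv : ∀ (ε : ℤˣ) (x : ℝ), Function.update (vertex (Function.update δ j ε)) i x =
            Function.update (Function.update (vertex δ) i x) j (sgn ε) := by
          intro ε x
          funext k
          by_cases hk : k = i
          · subst hk; simp [hij]
          · by_cases hk' : k = j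
            · subst hk'; simp [hk, vertex]
            · simp [hk, hk', vertex]
        refine ⟨_, hℓ.face hX (isFaceMap_square δ hij), fun t => ?_, fun t => ?_⟩
        · rw [ha]
          simp only [ContinuousMap.comp_apply, ContinuousMap.coe_mk, hv, sgn_neg_one]
          rfl
        · rw [hb]
          simp only [ContinuousMap.comp_apply, ContinuousMap.coe_mk, hv, sgn_one]
          rfl
      have h2 := hχ.par a b h1
      rwa [ha, hb] at h2
    have h3 : ∀ ε : ℤˣ, χ (edgeMap ℓ (Function.update δ j ε) i) =
        χ (edgeMap ℓ (Function.update δ j 1) i) := fun ε => by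
      rcases Int.units_eq_one_or ε with rfl | rfl
      · rfl
      · exact key
    rw [h3, ← h3 (δ j), Function.update_eq_self]

theorem edgeMap_eq {n : ℕ} {ℓ : C(Fin n → ℝ, E)} (hℓ : IsLiftedCube p ℓ) (δ δ' : Fin n → ℤˣ)
    (i : Fin n) : χ (edgeMap ℓ δ i) = χ (edgeMap ℓ δ' i) :=
  eq_of_update_invariant (fun δ => χ (edgeMap ℓ δ i))
    (fun δ j ε => hχ.edgeMap_update hX hℓ δ i j ε) δ δ'

/-- A coordinate frozen at `±1` contributes an integer, hence zero; a reversed coordinate changes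
the sign of the slope and shifts the value by an integer. Working in the circle makes the local
formulas agree without integration constants. -/
theorem toCircle_face {k n : ℕ} {ℓ : C(Fin n → ℝ, E)} (hℓ : IsLiftedCube p ℓ)
    {φ : (Fin k → ℝ) → Fin n → ℝ} (hφ : IsFaceMap φ) (t : Fin k → ℝ) :
    toCircle χ (ℓ.comp ⟨φ, hφ.continuous⟩) t = toCircle χ ℓ (φ t) := by
  have hc := hφ.continuous
  obtain ⟨ι, s, hι, h1, h2⟩ := id hφ
  choose! ε hε using h2
  refine Finset.sum_of_injOn ι hι.injOn (fun _ _ => Finset.mem_coe.2 (Finset.mem_univ _))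
    (fun j _ hj => ?_) (fun a _ => ?_)
  · have hj' : j ∉ range ι := by simpa using hj
    rw [hε j hj', clamp_sgn]
    rcases sgn_eq (ε j) with h | h <;> rw [h]
    · exact coe_eq_zero_of_int (χ (edgeMap ℓ 1 j)) (by ring)
    · exact coe_eq_zero_of_int 0 (by push_cast; ring)
  · obtain ⟨δ, hδ⟩ : ∃ δ : Fin n → ℤˣ, ∀ u : ℝ,
        φ (Function.update (vertex 1) a u) =
          Function.update (vertex δ) (ι a) (sgn (s a) * u) := by
      classical
      refine ⟨fun j => if h : j ∈ range ι then s h.choose else ε j, fun u => funext fun j => ?_⟩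
      by_cases hj : j ∈ range ι
      · obtain ⟨b, rfl⟩ := hj
        rw [h1]
        by_cases hab : b = a
        · subst hab; simp
        · have h3 : ∃ c, ι c = ι b := ⟨b, rfl⟩
          have h4 : h3.choose = b := hι h3.choose_spec
          rw [Function.update_of_ne hab, Function.update_of_ne (hι.ne hab)]
          simp [vertex, h4]
      · rw [hε j hj, Function.update_of_ne (by rintro rfl; exact hj ⟨a, rfl⟩)]
        simp only [vertex, dif_neg hj]
    obtain ⟨b, hb⟩ := LEdge.exists_map (hℓ.face hX (isFaceMap_edge δ (ι a)))
    have hb' : b.map = edgeMap ℓ δ (ι a) := hb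
    have hval : (χ (edgeMap (ℓ.comp ⟨φ, hc⟩) 1 a) : ℝ) = sgn (s a) * χ (edgeMap ℓ 1 (ι a)) := by
      rw [hχ.edgeMap_eq hX hℓ 1 δ (ι a)]
      rcases Int.units_eq_one_or (s a) with hs | hs
      · have : edgeMap (ℓ.comp ⟨φ, hc⟩) 1 a = edgeMap ℓ δ (ι a) := by
          ext t
          rw [edgeMap_apply, edgeMap_apply, comp_mk_apply, hδ, hs]
          simp
        rw [this, hs, sgn_one, one_mul]
      · have : edgeMap (ℓ.comp ⟨φ, hc⟩) 1 a = b.rev.map := by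
          ext t
          rw [edgeMap_apply, LEdge.rev_map, hb', edgeMap_apply, comp_mk_apply, hδ, hs]
          simp [sgn_neg_one]
        rw [this, hχ.rev, hb', hs, sgn_neg_one]
        push_cast
        ring
    rw [hval, h1, clamp_sgn_mul]
    rcases sgn_eq (s a) with h | h <;> rw [h]
    · congr 1; ring
    · exact coe_eq_coe_of_int (-χ (edgeMap ℓ 1 (ι a))) (by push_cast; ring)

/-- The clamped coordinates of absolute value less than `1` span the face having the point in its
interior. Its parametrization is normalized to lift `cm c` itself, so that uniqueness of lifts can
compare the faces obtained from two cubes. -/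
theorem exists_interior (hp : IsCoveringMap p) {n : ℕ} {ℓ : C(Fin n → ℝ, E)}
    (hℓ : IsLiftedCube p ℓ) (t : Fin n → ℝ) :
    ∃ (m : ℕ) (c : Cube X m) (ℓ' : C(Fin m → ℝ, E)) (t' : Fin m → ℝ),
      t' ∈ Metric.ball (0 : Fin m → ℝ) 1 ∧ (∀ u, p (ℓ' u) = cm c u) ∧ ℓ' t' = ℓ t ∧
        toCircle χ ℓ' t' = toCircle χ ℓ t := by
  classical
  let t₁ := clampMap n t
  let S := Finset.univ.filter fun i => |t₁ i| < 1
  let e : Fin S.card ≃ S := S.equivFin.symm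
  have h1 : ∀ j ∉ S, ∃ ε : ℤˣ, t₁ j = sgn ε := by
    intro j hj
    have hj' : ¬ |t₁ j| < 1 := by simpa [S] using hj
    have := clamp_mem (t j)
    have h2 : |t₁ j| = 1 := le_antisymm (abs_le.2 this) (not_lt.1 hj')
    rcases eq_or_eq_neg_of_abs_eq h2 with h | h
    · exact ⟨1, by rw [h, sgn_one]⟩
    · exact ⟨-1, by rw [h, sgn_neg_one]⟩
  let φ : (Fin S.card → ℝ) → Fin n → ℝ :=
    fun u j => if h : j ∈ S then u (e.symm ⟨j, h⟩) else t₁ j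
  have hφ : IsFaceMap φ := by
    refine ⟨fun a => (e a : Fin n), fun _ => 1, fun a b hab => e.injective (Subtype.ext hab),
      fun a u => ?_, fun j hj => ?_⟩
    · simp only [φ, dif_pos (e a).2]; simp
    · have hj' : j ∉ S := fun h => hj ⟨e.symm ⟨j, h⟩, by simp⟩
      obtain ⟨ε, hε⟩ := h1 j hj'
      exact ⟨ε, fun u => by simp only [φ, dif_neg hj', hε]⟩
  obtain ⟨u, hu, hφu⟩ : ∃ u ∈ Metric.ball (0 : Fin S.card → ℝ) 1, φ u = t₁ := by
    refine ⟨fun a => t₁ (e a), ?_, funext fun j => ?_⟩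
    · rw [mem_ball_zero_iff, pi_norm_lt_iff zero_lt_one]
      intro a
      exact (Finset.mem_filter.1 (e a).2).2
    · by_cases h : j ∈ S
      · simp only [φ, dif_pos h, Equiv.apply_symm_apply]
      · simp only [φ, dif_neg h]
  have hℓ₁ := hℓ.face hX hφ
  obtain ⟨c, σ, s, hc⟩ := id hℓ₁
  have hinv : ∀ v, cubeIso σ s (cubeIso σ.symm (fun j => s (σ.symm j)) v) = v := by
    intro v
    funext k
    simp [cubeIso, ← mul_assoc, sgn_mul_self]
  have hinv' : ∀ v, cubeIso σ.symm (fun j => s (σ.symm j)) (cubeIso σ s v) = v := by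
    intro v
    funext k
    simp [cubeIso, ← mul_assoc, sgn_mul_self]
  have hψ := isFaceMap_cubeIso σ.symm fun j => s (σ.symm j)
  refine ⟨S.card, c, (ℓ.comp ⟨φ, hφ.continuous⟩).comp ⟨_, hψ.continuous⟩, cubeIso σ s u, ?_,
    fun v => ?_, ?_, ?_⟩
  · rw [mem_ball_zero_iff, pi_norm_lt_iff zero_lt_one] at hu ⊢
    intro k
    have := hu (σ k)
    rw [cubeIso, norm_mul]
    rcases sgn_eq (s k) with h | h <;> rw [h] <;> simpa using this
  · rw [comp_mk_apply, hc, hinv]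
  · rw [comp_mk_apply, hinv', comp_mk_apply, hφu, hℓ.clampMap hp]
  · rw [hχ.toCircle_face hX hℓ₁ hψ, hinv', hχ.toCircle_face hX hℓ hφ, hφu, toCircle_clampMap]

theorem toCircle_eq (hp : IsCoveringMap p) {n n' : ℕ} {ℓ : C(Fin n → ℝ, E)}
    {ℓ' : C(Fin n' → ℝ, E)} (hℓ : IsLiftedCube p ℓ) (hℓ' : IsLiftedCube p ℓ') {t : Fin n → ℝ}
    {t' : Fin n' → ℝ} (h : ℓ t = ℓ' t') : toCircle χ ℓ t = toCircle χ ℓ' t' := by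
  obtain ⟨m, c, ℓ₁, t₁, ht₁, hc, h1, h2⟩ := hχ.exists_interior hX hp hℓ t
  obtain ⟨m', c', ℓ₁', t₁', ht₁', hc', h1', h2'⟩ := hχ.exists_interior hX hp hℓ' t'
  rw [← h2, ← h2']
  have h3 : ℓ₁ t₁ = ℓ₁' t₁' := by rw [h1, h1', h]
  have h4 := cm_eq_iff ht₁ ht₁' (by rw [← hc, ← hc', h3])
  obtain ⟨rfl, h5⟩ := Sigma.mk.inj_iff.1 h4
  obtain ⟨rfl, rfl⟩ := Prod.mk.injEq _ _ _ _ ▸ eq_of_heq h5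
  rw [lift_unique hp (ℓ := ℓ₁) (ℓ' := ℓ₁') (fun u => by rw [hc, hc']) t₁ h3]

theorem exists_circleMap [T2Space X] [CompactSpace X] (hp : IsCoveringMap p) :
    ∃ f : C(E, AddCircle (1 : ℝ)), ∀ (n : ℕ) (ℓ : C(Fin n → ℝ, E)), IsLiftedCube p ℓ →
      ∀ t, f (ℓ t) = toCircle χ ℓ t := by
  have hlift : ∀ {n : ℕ} (c : Cube X n) (e : E) (t : Fin n → ℝ), p e = cm c t →
      ∃ ℓ : C(Fin n → ℝ, E), IsLiftedCube p ℓ ∧ ℓ t = e ∧ ∀ u, p (ℓ u) = cm c u := by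
    intro n c e t h
    obtain ⟨ℓ, h1, h2⟩ := exists_lift hp (cm c) t e h
    exact ⟨ℓ, ⟨c, 1, 1, fun u => by rw [h2]; congr 1; funext k; simp [cubeIso]⟩, h1, h2⟩
  have hcover : ∀ e : E, ∃ (n : ℕ) (ℓ : C(Fin n → ℝ, E)) (t : Fin n → ℝ),
      IsLiftedCube p ℓ ∧ ℓ t = e := by
    intro e
    have h1 : p e ∈ ⋃ (n : ℕ) (c : Cube X n), RelCWComplex.closedCell n c := by
      rw [CWComplex.union]; trivial
    obtain ⟨n, c, t, ht, h2⟩ := by simpa only [mem_iUnion] using h1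
    obtain ⟨ℓ, h3, h4, -⟩ := hlift c e t (by rw [cm_of_mem c ht, ← h2])
    exact ⟨n, ℓ, t, h3, h4⟩
  choose n ℓ t hℓ ht using hcover
  let f : E → AddCircle (1 : ℝ) := fun e => toCircle χ (ℓ e) (t e)
  have hf : ∀ (n : ℕ) (ℓ : C(Fin n → ℝ, E)), IsLiftedCube p ℓ →
      ∀ t, f (ℓ t) = toCircle χ ℓ t :=
    fun n ℓ' h u => hχ.toCircle_eq hX hp (hℓ _) h (ht _)
  -- Continuity is tested on an ultrafilter `g` converging to `e`. As `X` has finitely many cells,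
  -- the image of `g` lives on one closed cell, hence comes from an ultrafilter `V` on a compact
  -- cube; its limit `u` lies over `p e`, and the lift of this cube through `e` carries `V` to `g`.
  refine ⟨⟨f, continuous_iff_ultrafilter.2 fun e g hg => ?_⟩, hf⟩
  have := finite_cells X
  obtain ⟨x, hx⟩ : ∃ x : Σ n, Cube X n, RelCWComplex.closedCell x.1 x.2 ∈ g.map p := by
    have h1 : (⋃ x ∈ (univ : Set (Σ n, Cube X n)), RelCWComplex.closedCell x.1 x.2) ∈ g.map p := by
      have h2 : (⋃ x ∈ (univ : Set (Σ n, Cube X n)), RelCWComplex.closedCell x.1 x.2) = univ := by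
        rw [biUnion_univ, iUnion_sigma]
        exact CWComplex.union (C := (univ : Set X))
      rw [h2]
      exact Filter.univ_mem
    obtain ⟨x, -, hx⟩ := (Ultrafilter.finite_biUnion_mem_iff finite_univ).1 h1
    exact ⟨x, hx⟩
  obtain ⟨m, c⟩ := x
  have hx' : cm c '' stdCube m ∈ g.map p := by
    refine Filter.mem_of_superset hx ?_
    rintro _ ⟨u, hu, rfl⟩
    exact ⟨u, hu, cm_of_mem c hu⟩
  let B : Filter (Fin m → ℝ) := (g.map p : Filter X).comap (cm c) ⊓ Filter.principal (stdCube m)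
  have : B.NeBot := by
    rw [Filter.inf_principal_neBot_iff]
    rintro U ⟨W, hW, hWU⟩
    obtain ⟨_, h1, u, hu, rfl⟩ := (g.map p).nonempty_of_mem (Filter.inter_mem hW hx')
    exact ⟨u, hWU h1, hu⟩
  let V := Ultrafilter.of B
  have hVB : (V : Filter _) ≤ B := Ultrafilter.of_le B
  have hV : V.map (cm c) = g.map p :=
    Ultrafilter.coe_le_coe.1 (Filter.map_le_iff_le_comap.2 (hVB.trans inf_le_left))
  obtain ⟨u, -, hu⟩ := isCompact_iff_ultrafilter_le_nhds.1
    (isCompact_closedBall (0 : Fin m → ℝ) 1) V (hVB.trans inf_le_right)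
  have hpe : p e = cm c u := by
    have h1 : Filter.Tendsto (cm c) V (𝓝 (cm c u)) := ((cm c).continuous.tendsto u).mono_left hu
    have h2 : Filter.Tendsto p g (𝓝 (p e)) := (hp.continuous.tendsto e).mono_left hg
    have h3 : ((V.map (cm c) : Ultrafilter X) : Filter X) ≤ 𝓝 (cm c u) := h1
    rw [hV] at h3
    exact tendsto_nhds_unique h2 h3
  obtain ⟨k, hk, hku, hpk⟩ := hlift c e u hpe
  obtain ⟨U, hU, hUinj⟩ := isLocallyInjective_iff_nhds.1 hp.isLocalHomeomorph.isLocallyInjective e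
  have hkV : Filter.Tendsto k V (𝓝 e) := by
    rw [← hku]; exact (k.continuous.tendsto u).mono_left hu
  -- The two ultrafilters have the same image under `p` and both contain `U`, on which `p` is
  -- injective.
  have hVg : V.map k = g := by
    refine Ultrafilter.coe_le_coe.1 fun S hS => ?_
    have h1 : p '' (S ∩ U) ∈ V.map (cm c) := by
      rw [hV]
      have h2 : U ∈ (g : Filter E) := hg hU
      have h3 : p ⁻¹' (p '' (S ∩ U)) ∈ (g : Filter E) :=
        Filter.mem_of_superset (Filter.inter_mem hS h2) (subset_preimage_image p _)
      exact h3
    have h3 : cm c ⁻¹' (p '' (S ∩ U)) ∈ (V : Filter (Fin m → ℝ)) := h1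
    have h4 : k ⁻¹' U ∈ (V : Filter (Fin m → ℝ)) := hkV hU
    suffices h5 : k ⁻¹' S ∈ (V : Filter (Fin m → ℝ)) from h5
    refine Filter.mem_of_superset (Filter.inter_mem h3 h4) ?_
    rintro v ⟨⟨s, ⟨hs, hsU⟩, hsv⟩, hvU⟩
    have h2 : k v = s := hUinj hvU hsU ((hpk v).trans hsv.symm)
    exact mem_preimage.2 (h2 ▸ hs)
  rw [← hVg, Ultrafilter.coe_map, Filter.tendsto_map'_iff, ← hku, hf m k hk]
  have h3 : f ∘ k = toCircle χ k := funext fun v => hf m k hk v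
  rw [h3]
  exact ((continuous_toCircle χ k).tendsto u).mono_left hu

end IsCocycle

/-! ### Sums over closed paths -/

/-- The list `l` of oriented edges of `E` is a path from `u` to `v`. -/
def IsPath (u : E) : List (LEdge p) → E → Prop
  | [], v => u = v
  | a :: l, v => a.org = u ∧ IsPath a.ter l v

theorem isPath_append {u v : E} {l l' : List (LEdge p)} :
    IsPath u (l ++ l') v ↔ ∃ u', IsPath u l u' ∧ IsPath u' l' v := by
  induction l generalizing u with
  | nil => simp [IsPath]
  | cons a l ih => simp [IsPath, ih, and_assoc]

/-- The parametrization of an oriented edge of `E` by the unit interval. -/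
def LEdge.path (a : LEdge p) : Path a.org a.ter where
  toFun t := a.map fun _ => 2 * (t : ℝ) - 1
  continuous_toFun := a.map.continuous.comp (by fun_prop)
  source' := by simp [LEdge.org]
  target' := by
    rw [LEdge.ter]
    congr 1
    funext
    simp
    norm_num

theorem LEdge.path_apply (a : LEdge p) (t : unitInterval) :
    a.path t = a.map fun _ => 2 * (t : ℝ) - 1 := rfl

section circleMap

variable {χ : C(Fin 1 → ℝ, E) → ℤ} (f : C(E, AddCircle (1 : ℝ)))
  (hf : ∀ (n : ℕ) (ℓ : C(Fin n → ℝ, E)), IsLiftedCube p ℓ → ∀ t, f (ℓ t) = toCircle χ ℓ t)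

include hf

theorem circleMap_edge (a : LEdge p) (t : Fin 1 → ℝ) :
    f (a.map t) = ((χ a.map * ((clamp (t 0) + 1) / 2) : ℝ) : AddCircle (1 : ℝ)) := by
  rw [hf 1 a.map a.isLiftedCube, toCircle, Fin.sum_univ_one]
  have : edgeMap a.map 1 0 = a.map := by
    ext t
    rw [edgeMap_apply]
    congr 1
    funext k
    rw [Subsingleton.elim k 0]
    simp
  rw [this]

theorem circleMap_path (a : LEdge p) (t : unitInterval) :
    f (a.path t) = ((χ a.map * (t : ℝ) : ℝ) : AddCircle (1 : ℝ)) := by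
  rw [LEdge.path_apply, circleMap_edge f hf, clamp_of_mem]
  · congr 2; ring
  · have := t.2
    constructor <;> linarith [this.1, this.2]

/-- The real lift is affine with slope `χ a.map` on each edge, so its displacement is the sum. The
path `γ` is chosen before the starting value `r`. -/
theorem exists_real_path {u v : E} {l : List (LEdge p)} (h : IsPath u l v) :
    ∃ γ : Path u v, ∀ r : ℝ, (r : AddCircle (1 : ℝ)) = f u →
      ∃ Γ : Path r (r + (l.map fun a => χ a.map).sum), ∀ t, (Γ t : AddCircle (1 : ℝ)) = f (γ t) := by
  induction l generalizing u with
  | nil =>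
    obtain rfl : u = v := h
    refine ⟨Path.refl u, fun r hr => ⟨(Path.refl r).cast rfl (by simp), fun t => ?_⟩⟩
    simpa using hr
  | cons a l ih =>
    obtain ⟨rfl, h⟩ := h
    obtain ⟨γ, hγ⟩ := ih h
    refine ⟨a.path.trans γ, fun r hr => ?_⟩
    have h0 : f a.org = 0 := by
      have := circleMap_path f hf a 0
      simpa using this
    have h1 : f a.ter = 0 := by
      have := circleMap_path f hf a 1
      rw [a.path.target] at this
      rw [this]
      exact coe_eq_zero_of_int (χ a.map) (by simp)
    rw [h0] at hr
    let Γ₁ : Path r (r + χ a.map) :=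
      { toFun := fun t => r + χ a.map * t
        continuous_toFun := by fun_prop
        source' := by simp
        target' := by simp }
    have hr' : ((r + χ a.map : ℝ) : AddCircle (1 : ℝ)) = 0 := by
      rw [AddCircle.coe_add, hr, coe_eq_zero_of_int (χ a.map) rfl, add_zero]
    obtain ⟨Γ, hΓ⟩ := hγ (r + χ a.map) (hr'.trans h1.symm)
    refine ⟨(Γ₁.trans Γ).cast rfl (by simp [add_assoc]), fun t => ?_⟩
    rw [Path.cast_coe, Path.trans_apply, Path.trans_apply]
    split_ifs
    · rw [circleMap_path f hf]
      change ((r + χ a.map * _ : ℝ) : AddCircle (1 : ℝ)) = _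
      rw [AddCircle.coe_add, hr, zero_add]
    · exact hΓ _

/-- The image of the loop in the circle is null-homotopic, so its lift to the line ends where the
constant lift does. -/
theorem sum_eq_zero_of_circleMap [SimplyConnectedSpace E] {u : E} {l : List (LEdge p)}
    (h : IsPath u l u) : (l.map fun a => χ a.map).sum = 0 := by
  obtain ⟨γ, hγ⟩ := exists_real_path f hf h
  obtain ⟨r, hr⟩ := QuotientAddGroup.mk_surjective (f u)
  obtain ⟨Γ, hΓ⟩ := hγ r hr
  have h1 := (SimplyConnectedSpace.paths_homotopic γ (Path.refl u)).map f
  have h2 := (AddCircle.isCoveringMap_coe (1 : ℝ)).liftPath_apply_one_eq_of_homotopicRel h1 r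
    (by simpa using hr.symm) (by simpa using hr.symm)
  have h3 := ((AddCircle.isCoveringMap_coe (1 : ℝ)).eq_liftPath_iff'
    (γ := (γ.map f.continuous).toContinuousMap) (e := r) (by simpa using hr.symm)
    (Γ := Γ.toContinuousMap)).2 ⟨funext fun t => hΓ t, Γ.source⟩
  have h4 := ((AddCircle.isCoveringMap_coe (1 : ℝ)).eq_liftPath_iff'
    (γ := ((Path.refl u).map f.continuous).toContinuousMap) (e := r) (by simpa using hr.symm)
    (Γ := (Path.refl r).toContinuousMap)).2 ⟨funext fun t => hr, rfl⟩
  rw [← h3, ← h4] at h2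
  have h5 : r + ((l.map fun a => χ a.map).sum : ℤ) = r := by
    have h6 : Γ 1 = Path.refl r 1 := h2
    simpa using h6
  exact_mod_cast (add_eq_left.1 h5)

end circleMap

theorem IsCocycle.sum_eq_zero [T2Space X] [CompactSpace X] [SimplyConnectedSpace E]
    {χ : C(Fin 1 → ℝ, E) → ℤ} (hχ : IsCocycle p χ) (hX : IsCubeComplex X) (hp : IsCoveringMap p)
    {u : E} {l : List (LEdge p)} (h : IsPath u l u) : (l.map fun a => χ a.map).sum = 0 := by
  obtain ⟨f, hf⟩ := hχ.exists_circleMap hX hp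
  exact sum_eq_zero_of_circleMap f hf h

end CubeCpx

namespace CubeCpx

variable {X : Type*} [TopologicalSpace X] [CWComplex (univ : Set X)]

/-! ## Hyperplanes -/

theorem IsCornerEdge.rev {n : ℕ} {c : Cube X n} {δ : Fin n → ℤˣ} {i : Fin n} {a : OEdge X}
    (h : IsCornerEdge c δ i a) : IsCornerEdge c (Function.update δ i (-δ i)) i a.rev := by
  intro t ht
  rw [OEdge.rev_param, ← h (-t) ⟨by linarith [ht.2], by linarith [ht.1]⟩]
  congr 1
  funext k
  by_cases hk : k = i
  · subst hk; simp [sgn_neg]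
  · simp [hk, vertex]

theorem ParallelInSquare.rev {a b : OEdge X} (h : ParallelInSquare a b) :
    ParallelInSquare a.rev b.rev := by
  obtain ⟨q, δ, i, j, hij, ha, hb⟩ := h
  refine ⟨q, _, i, j, hij, ha.rev, ?_⟩
  have := hb.rev
  rw [Function.update_of_ne hij] at this
  rwa [Function.update_of_ne hij.symm, Function.update_comm hij]

theorem ParallelInSquare.hyp_eq {a b : OEdge X} (h : ParallelInSquare a b) : a.hyp = b.hyp :=
  Quot.sound ⟨a.dir, b.dir, h⟩

/-- The oriented hyperplane with the opposite orientation. -/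
def OHyperplane.inv : OHyperplane X → OHyperplane X :=
  Quot.map OEdge.rev fun _ _ h => h.rev

/-- The hyperplane underlying an oriented hyperplane. -/
def OHyperplane.hyp : OHyperplane X → Hyperplane X :=
  Quot.lift OEdge.hyp fun _ _ h => h.hyp_eq

theorem OEdge.rev_ohyp (a : OEdge X) : a.rev.ohyp = a.ohyp.inv := rfl

theorem OEdge.ohyp_hyp (a : OEdge X) : a.ohyp.hyp = a.hyp := rfl

theorem OHyperplane.inv_inv (J : OHyperplane X) : J.inv.inv = J := by
  induction J using Quot.ind with
  | mk a => exact congrArg (Quot.mk _) a.rev_rev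

theorem OHyperplane.inv_hyp (J : OHyperplane X) : J.inv.hyp = J.hyp := by
  induction J using Quot.ind with
  | mk a => rfl

namespace IsSpecial

variable (hX : IsSpecial X)

include hX

theorem inv_ne (J : OHyperplane X) : J.inv ≠ J := by
  induction J using Quot.ind with
  | mk a => exact (hX.twoSided a).symm

theorem not_transverse_self (J : Hyperplane X) : ¬ Transverse J J :=
  hX.not_selfIntersecting J

theorem spanSquare {a b : OEdge X} (h : Transverse a.hyp b.hyp) (hab : a.origin = b.origin) :
    SpanSquare a b := by
  by_contra hcon
  refine hX.not_interOsculating a.hyp b.hyp ⟨fun heq => ?_, h, a, b, rfl, rfl, hab, hcon⟩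
  rw [heq] at h
  exact hX.not_transverse_self _ h

/-- If the edges were distinct, the absence of self-osculation would give a square with both sides
dual to one hyperplane, a self-intersection. -/
theorem eq_of_ohyp_eq {a b : OEdge X} (h : a.ohyp = b.ohyp) (hab : a.origin = b.origin) :
    a = b := by
  by_contra hne
  refine hX.not_selfOsculating b.ohyp ⟨a, b, hne, h, rfl, .inl ⟨hab, fun hs => ?_⟩⟩
  refine hX.not_transverse_self b.hyp ⟨a, b, ?_, rfl, hs⟩
  rw [← OEdge.ohyp_hyp, h]; rfl

end IsSpecial

/-! ## Squares of the covering space -/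

variable {E : Type*} [TopologicalSpace E] {p : E → X}

theorem isFaceMap_flip : IsFaceMap fun t : Fin 2 → ℝ => ![-t 0, t 1] := by
  refine ⟨id, ![-1, 1], Function.injective_id, fun a t => ?_, fun j hj => absurd ⟨j, rfl⟩ hj⟩
  fin_cases a <;> simp [sgn_neg_one]

theorem isFaceMap_swap : IsFaceMap fun t : Fin 2 → ℝ => ![t 1, t 0] := by
  refine ⟨![1, 0], 1, ?_, fun a t => ?_, fun j hj => ?_⟩
  · intro a b; fin_cases a <;> fin_cases b <;> simp
  · fin_cases a <;> simp
  · fin_cases j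
    · exact absurd ⟨1, rfl⟩ hj
    · exact absurd ⟨0, rfl⟩ hj

theorem isFaceMap_horizontal (ε : ℤˣ) : IsFaceMap fun t : Fin 1 → ℝ => ![t 0, sgn ε] := by
  convert isFaceMap_edge ![-1, ε] 0 using 2
  rw [update_vertex_zero]

theorem isFaceMap_vertical (ε : ℤˣ) : IsFaceMap fun t : Fin 1 → ℝ => ![sgn ε, t 0] := by
  convert isFaceMap_edge ![ε, -1] 1 using 2
  rw [update_vertex_one]

section squares

variable (hX : IsCubeComplex X) {ℓ : C(Fin 2 → ℝ, E)} (hℓ : IsLiftedCube p ℓ)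

include hX hℓ

theorem exists_horizontal (ε : ℤˣ) : ∃ a : LEdge p, ∀ t, a.map t = ℓ ![t 0, sgn ε] := by
  obtain ⟨a, ha⟩ := LEdge.exists_map (hℓ.face hX (isFaceMap_horizontal ε))
  exact ⟨a, fun t => by rw [ha]; rfl⟩

theorem exists_vertical (ε : ℤˣ) : ∃ a : LEdge p, ∀ t, a.map t = ℓ ![sgn ε, t 0] := by
  obtain ⟨a, ha⟩ := LEdge.exists_map (hℓ.face hX (isFaceMap_vertical ε))
  exact ⟨a, fun t => by rw [ha]; rfl⟩

theorem IsCorner.exists_opposite {a b : LEdge p} (h : IsCorner ℓ a b) :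
    ∃ a' b' : LEdge p, Par a a' ∧ Par b b' ∧ a'.org = b.ter ∧ b'.org = a.ter ∧
      a'.ter = b'.ter := by
  obtain ⟨a', ha'⟩ := exists_horizontal hX hℓ 1
  obtain ⟨b', hb'⟩ := exists_vertical hX hℓ 1
  simp only [sgn_one] at ha' hb'
  refine ⟨a', b', ⟨ℓ, hℓ, h.1, ha'⟩, ⟨_, hℓ.face hX isFaceMap_swap, fun t => ?_, fun t => ?_⟩,
    ?_, ?_, ?_⟩
  · rw [h.2, comp_mk_apply]; rfl
  · rw [hb', comp_mk_apply]; rfl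
  · rw [LEdge.org, ha', LEdge.ter, h.2]
  · rw [LEdge.org, hb', LEdge.ter, h.1]
  · rw [LEdge.ter, ha', LEdge.ter, hb']

end squares

theorem Par.rev (hX : IsCubeComplex X) {a b : LEdge p} (h : Par a b) : Par a.rev b.rev := by
  obtain ⟨ℓ, hℓ, ha, hb⟩ := h
  refine ⟨_, hℓ.face hX isFaceMap_flip, fun t => ?_, fun t => ?_⟩
  · rw [LEdge.rev_map, ha, comp_mk_apply]; rfl
  · rw [LEdge.rev_map, hb, comp_mk_apply]; rfl

theorem Par.exists_edge (hX : IsCubeComplex X) {a b : LEdge p} (h : Par a b) :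
    ∃ c : LEdge p, c.org = a.ter ∧ c.ter = b.ter ∧ Transverse a.base.hyp c.base.hyp := by
  obtain ⟨ℓ, hℓ, ha, hb⟩ := h
  obtain ⟨c, hc⟩ := exists_vertical hX hℓ 1
  rw [sgn_one] at hc
  refine ⟨c, by rw [LEdge.org, hc, LEdge.ter, ha], by rw [LEdge.ter, hc, LEdge.ter, hb],
    a.rev.base, c.base, rfl, rfl, ?_⟩
  have hcor : IsCorner (ℓ.comp ⟨_, isFaceMap_flip.continuous⟩) a.rev c := by
    refine ⟨fun t => ?_, fun t => ?_⟩
    · rw [LEdge.rev_map, ha, comp_mk_apply]; rfl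
    · rw [hc, comp_mk_apply]; simp
  exact hcor.spanSquare (hℓ.face hX isFaceMap_flip)

theorem isPath_reverse {u v : E} {l : List (LEdge p)} (h : IsPath u l v) :
    IsPath v (l.reverse.map LEdge.rev) u := by
  induction l generalizing u with
  | nil => exact Eq.symm h
  | cons a l ih =>
    obtain ⟨rfl, h⟩ := h
    rw [List.reverse_cons, List.map_append, isPath_append]
    exact ⟨_, ih h, a.rev_org, a.rev_ter⟩

theorem hyp_eq_of_eqvGen {a b : LEdge p} (h : Relation.EqvGen Par a b) :
    a.base.hyp = b.base.hyp := by
  induction h with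
  | rel a b h => exact h.parallelInSquare.hyp_eq
  | refl a => rfl
  | symm a b _ ih => exact ih.symm
  | trans a b c _ _ ih ih' => exact ih.trans ih'

/-- Two edges of `E` which are dual to the same oriented hyperplane are joined by a path in the
carrier of this hyperplane. -/
theorem exists_carrier_path (hX : IsCubeComplex X) {a b : LEdge p}
    (h : Relation.EqvGen Par a b) : ∃ l : List (LEdge p), IsPath a.ter l b.ter ∧
      ∀ c ∈ l, Transverse a.base.hyp c.base.hyp := by
  induction h with
  | rel a b h =>
    obtain ⟨c, h1, h2, h3⟩ := h.exists_edge hX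
    exact ⟨[c], ⟨h1, h2⟩, by simpa using h3⟩
  | refl a => exact ⟨[], rfl, by simp⟩
  | symm a b hab ih =>
    obtain ⟨l, h1, h2⟩ := ih
    refine ⟨_, isPath_reverse h1, fun c hc => ?_⟩
    obtain ⟨d, hd, rfl⟩ := List.mem_map.1 hc
    rw [← hyp_eq_of_eqvGen hab]
    exact h2 d (List.mem_reverse.1 hd)
  | trans a b c hab _ ih ih' =>
    obtain ⟨l, h1, h2⟩ := ih
    obtain ⟨l', h1', h2'⟩ := ih'
    refine ⟨l ++ l', isPath_append.2 ⟨_, h1, h1'⟩, fun d hd => ?_⟩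
    rcases List.mem_append.1 hd with hd | hd
    · exact h2 d hd
    · rw [hyp_eq_of_eqvGen hab]
      exact h2' d hd

/-! ### Hyperplanes of the covering space -/

/-- The oriented hyperplane of `E` dual to an oriented edge. -/
def LEdge.cls (a : LEdge p) : Quot (Par (p := p)) := Quot.mk _ a

theorem LEdge.cls_eq_iff {a b : LEdge p} : a.cls = b.cls ↔ Relation.EqvGen Par a b := Quot.eq

theorem LEdge.ohyp_eq_of_cls_eq {a b : LEdge p} (h : a.cls = b.cls) :
    a.base.ohyp = b.base.ohyp :=
  congrArg (Quot.lift (fun a : LEdge p => a.base.ohyp)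
    fun _ _ h => Quot.sound h.parallelInSquare) h

theorem LEdge.cls_rev_eq (hX : IsCubeComplex X) {a b : LEdge p} (h : a.cls = b.cls) :
    a.rev.cls = b.rev.cls :=
  congrArg (Quot.map (ra := Par) (rb := Par) LEdge.rev fun _ _ h => h.rev hX) h

theorem LEdge.cls_rev_comm (hX : IsCubeComplex X) {a b : LEdge p} (h : a.rev.cls = b.cls) :
    b.rev.cls = a.cls := by
  have := LEdge.cls_rev_eq hX h
  rw [LEdge.rev_rev] at this
  exact this.symm

/-! ### Signed crossings with a hyperplane of the covering space -/

open Classical in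
/-- The crossings, counted with signs, of an oriented edge of `E` with an oriented hyperplane. -/
def crossing (W : Quot (Par (p := p))) (g : C(Fin 1 → ℝ, E)) : ℤ :=
  (if ∃ a : LEdge p, a.map = g ∧ a.cls = W then 1 else 0) -
    if ∃ a : LEdge p, a.map = g ∧ a.rev.cls = W then 1 else 0

open Classical in
theorem crossing_map (W : Quot (Par (p := p))) (a : LEdge p) :
    crossing W a.map = (if a.cls = W then 1 else 0) - if a.rev.cls = W then 1 else 0 := by
  have h : ∀ P : LEdge p → Prop, (∃ b : LEdge p, b.map = a.map ∧ P b) ↔ P a := fun P =>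
    ⟨fun ⟨b, hb, hP⟩ => LEdge.ext_map hb ▸ hP, fun hP => ⟨a, rfl, hP⟩⟩
  simp only [crossing, h fun b => b.cls = W, h fun b => b.rev.cls = W]

theorem isCocycle_crossing (hX : IsCubeComplex X) (W : Quot (Par (p := p))) :
    IsCocycle p (crossing W) where
  rev a := by
    rw [crossing_map, crossing_map, LEdge.rev_rev]
    ring
  par a b h := by
    have h1 : a.cls = b.cls := Quot.sound h
    rw [crossing_map, crossing_map, h1, LEdge.cls_rev_eq hX h1]

theorem sum_crossing_pos {W : Quot (Par (p := p))} {l : List (LEdge p)}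
    (h : ∀ b ∈ l, b.rev.cls ≠ W) {a : LEdge p} (ha : a ∈ l) (haW : a.cls = W) :
    0 < (l.map fun a => crossing W a.map).sum := by
  have hnn : ∀ b ∈ l, 0 ≤ crossing W b.map := fun b hb => by
    rw [crossing_map, if_neg (h b hb)]
    split_ifs <;> norm_num
  have h1 : crossing W a.map = 1 := by rw [crossing_map, if_pos haW, if_neg (h a ha)]; norm_num
  have h2 := List.single_le_sum (l := l.map fun a => crossing W a.map)
    (by simpa using hnn) _ (List.mem_map_of_mem (f := fun a => crossing W a.map) ha)
  rw [h1] at h2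
  exact lt_of_lt_of_le zero_lt_one h2

theorem sum_reverse {χ : C(Fin 1 → ℝ, E) → ℤ} (hχ : IsCocycle p χ) (l : List (LEdge p)) :
    ((l.reverse.map LEdge.rev).map fun a => χ a.map).sum = -(l.map fun a => χ a.map).sum := by
  induction l with
  | nil => simp
  | cons a l ih =>
    rw [List.reverse_cons, List.map_append, List.map_append, List.sum_append, ih]
    simp [hχ.rev]

theorem cls_rev_ne (hX : IsSpecial X) (a : LEdge p) : a.rev.cls ≠ a.cls := fun h =>
  hX.inv_ne a.base.ohyp (LEdge.ohyp_eq_of_cls_eq h)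

section closedPath

variable [T2Space X] [CompactSpace X] [SimplyConnectedSpace E] (hX : IsSpecial X)
  (hp : IsCoveringMap p)

include hX hp

/-- The path `s` and a path `l` in the carrier of the hyperplane of `a` have the same ends. By
`hsk`, `s` crosses the hyperplane of `k` in one direction only, so its signed count is positive and
`l` must cross this hyperplane too. All edges of `l` are transverse to `a`. -/
theorem transverse_of_innermost {a b : LEdge p} {s : List (LEdge p)} (hs : IsPath a.ter s b.org)
    (hab : b.rev.cls = a.cls) {k : LEdge p} (hk : k ∈ s) (hsk : ∀ c ∈ s, c.rev.cls ≠ k.cls) :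
    Transverse a.base.hyp k.base.hyp := by
  obtain ⟨l, hl, hl'⟩ := exists_carrier_path hX.isCubeComplex (LEdge.cls_eq_iff.1 hab.symm)
  rw [LEdge.rev_ter] at hl
  have hχ := isCocycle_crossing hX.isCubeComplex k.cls
  have h1 := hχ.sum_eq_zero hX.isCubeComplex hp
    (isPath_append.2 ⟨_, hs, isPath_reverse hl⟩)
  rw [List.map_append, List.sum_append, sum_reverse hχ] at h1
  have h2 := sum_crossing_pos hsk hk rfl
  have h3 : (l.map fun a => crossing k.cls a.map).sum ≠ 0 := by omega
  obtain ⟨d, hd, hdk⟩ : ∃ d ∈ l, crossing k.cls d.map ≠ 0 := by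
    by_contra hcon
    push Not at hcon
    exact h3 (List.sum_eq_zero (by simpa using hcon))
  have h4 : d.base.hyp = k.base.hyp := by
    by_cases h5 : d.cls = k.cls
    · exact hyp_eq_of_eqvGen (LEdge.cls_eq_iff.1 h5)
    · by_cases h6 : d.rev.cls = k.cls
      · exact hyp_eq_of_eqvGen (a := d.rev) (LEdge.cls_eq_iff.1 h6)
      · rw [crossing_map, if_neg h5, if_neg h6] at hdk
        exact absurd rfl hdk
  rw [← h4]
  exact hl' d hd

theorem exists_cancellation {u : E} {l : List (LEdge p)} (hl : IsPath u l u) (hne : l ≠ []) :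
    ∃ x a s b y, l = x ++ a :: (s ++ b :: y) ∧ b.rev.cls = a.cls ∧
      ∀ k ∈ s, Transverse a.base.hyp k.base.hyp := by
  classical
  -- Some hyperplane is crossed back, since the signed count of crossings with that of the first
  -- edge vanishes. A pair with the smallest gap is then selected.
  have hex : ∃ N : ℕ, ∃ x a s b y, l = x ++ a :: (s ++ b :: y) ∧ b.rev.cls = a.cls ∧
      s.length = N := by
    obtain ⟨a, l', rfl⟩ := List.exists_cons_of_ne_nil hne
    obtain ⟨b, hb, hba⟩ : ∃ b ∈ a :: l', b.rev.cls = a.cls := by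
      by_contra hcon
      push Not at hcon
      have h1 := sum_crossing_pos hcon List.mem_cons_self rfl
      rw [(isCocycle_crossing hX.isCubeComplex a.cls).sum_eq_zero hX.isCubeComplex hp hl] at h1
      exact lt_irrefl _ h1
    rcases List.mem_cons.1 hb with rfl | hb
    · exact absurd hba (cls_rev_ne hX b)
    · obtain ⟨s, y, rfl⟩ := List.append_of_mem hb
      exact ⟨_, [], a, s, b, y, rfl, hba, rfl⟩
  obtain ⟨x, a, s, b, y, rfl, hba, hN⟩ := Nat.find_spec hex
  have hmin : ∀ x' a' s' b' y', x ++ a :: (s ++ b :: y) = x' ++ a' :: (s' ++ b' :: y') →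
      b'.rev.cls = a'.cls → ¬ s'.length < s.length := fun x' a' s' b' y' h1 h2 h3 =>
    Nat.find_min hex (hN ▸ h3) ⟨x', a', s', b', y', h1, h2, rfl⟩
  refine ⟨x, a, s, b, y, rfl, hba, fun k hk => ?_⟩
  obtain ⟨_, -, -, h1⟩ := isPath_append.1 hl
  obtain ⟨e, hs, rfl, -⟩ := isPath_append.1 h1
  -- An edge `c` of `s` crossing the hyperplane of `k` backwards would form with `k` a pair with a
  -- smaller gap.
  refine transverse_of_innermost hX hp hs hba hk fun c hc hck => ?_
  obtain ⟨s₁, s₂, rfl⟩ := List.append_of_mem hk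
  rcases List.mem_append.1 hc with hc | hc
  · obtain ⟨t₁, t₂, rfl⟩ := List.append_of_mem hc
    refine hmin (x ++ a :: t₁) c t₂ k (s₂ ++ b :: y) (by simp)
      (LEdge.cls_rev_comm hX.isCubeComplex hck) ?_
    simp only [List.length_append, List.length_cons]; omega
  · rcases List.mem_cons.1 hc with rfl | hc
    · exact cls_rev_ne hX _ hck
    · obtain ⟨t₁, t₂, rfl⟩ := List.append_of_mem hc
      refine hmin (x ++ a :: s₁) k t₁ c (t₂ ++ b :: y) (by simp) hck ?_
      simp only [List.length_append, List.length_cons]; omega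

end closedPath

/-! ### The labelled graph of a covering space -/

/-- The `1`-skeleton of `E`, whose oriented edges are labelled by the oriented hyperplanes of `X`. -/
def labelledGraph (hX : IsSpecial X) (hp : IsCoveringMap p) : LabelledGraph E (OHyperplane X) where
  Step u J v := ∃ a : LEdge p, a.org = u ∧ a.ter = v ∧ a.base.ohyp = J
  inv := OHyperplane.inv
  T J H := Transverse J.hyp H.hyp
  inv_ne := hX.inv_ne
  T_irrefl _ := hX.not_transverse_self _
  step_inv := by
    rintro u J v ⟨a, rfl, rfl, rfl⟩
    exact ⟨a.rev, a.rev_org, a.rev_ter, rfl⟩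
  step_unique := by
    rintro u J v v' ⟨a, rfl, rfl, rfl⟩ ⟨b, hab, rfl, hJ⟩
    rw [LEdge.ext_org hp (hX.eq_of_ohyp_eq hJ (by rw [← b.p_org, hab, a.p_org])) hab]
  swap := by
    rintro u v w J H hJH ⟨a, rfl, rfl, rfl⟩ ⟨b, hab, rfl, rfl⟩
    -- The edges `a.rev` and `b` start at the middle vertex, where they span a square. The path
    -- through its opposite corner carries the labels in the other order.
    have horg : a.rev.org = b.org := by rw [a.rev_org, hab]
    obtain ⟨ℓ, hℓ, hc⟩ := exists_isCorner hp
      (hX.spanSquare (a := a.rev.base) hJH (by rw [← a.rev.p_org, ← b.p_org, horg])) horg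
    obtain ⟨a', b', h1, h2, h3, h4, h5⟩ := hc.exists_opposite hX.isCubeComplex hℓ
    refine ⟨b'.ter, ⟨b', by rw [h4, LEdge.rev_ter], rfl, ?_⟩,
      ⟨a'.rev, by rw [LEdge.rev_org, h5], by rw [LEdge.rev_ter, h3], ?_⟩⟩
    · exact (Quot.sound h2.parallelInSquare).symm
    · have : a'.base.ohyp = a.base.rev.ohyp := (Quot.sound h1.parallelInSquare).symm
      change a'.base.ohyp.inv = _
      rw [this, OEdge.rev_ohyp, OHyperplane.inv_inv]

theorem reads_iff {hX : IsSpecial X} {hp : IsCoveringMap p} {u v : E} {w : List (OHyperplane X)} :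
    (labelledGraph hX hp).Reads u w v ↔
      ∃ l : List (LEdge p), IsPath u l v ∧ l.map (fun a => a.base.ohyp) = w := by
  induction w generalizing u with
  | nil =>
    simp only [LabelledGraph.reads_nil, List.map_eq_nil_iff]
    exact ⟨fun h => ⟨[], h, rfl⟩, by rintro ⟨_, h, rfl⟩; exact h⟩
  | cons J w ih =>
    rw [LabelledGraph.reads_cons]
    constructor
    · rintro ⟨_, ⟨a, rfl, rfl, rfl⟩, h⟩
      obtain ⟨l, hl, rfl⟩ := ih.1 h
      exact ⟨a :: l, ⟨rfl, hl⟩, rfl⟩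
    · rintro ⟨l, hl, hw⟩
      obtain ⟨a, l, rfl, rfl, hlw⟩ := List.map_eq_cons_iff.1 hw
      exact ⟨_, ⟨a, hl.1, rfl, rfl⟩, ih.2 ⟨l, hl.2, hlw⟩⟩

theorem coherent_labelledGraph [T2Space X] [CompactSpace X] [SimplyConnectedSpace E]
    (hX : IsSpecial X) (hp : IsCoveringMap p) : (labelledGraph hX hp).Coherent := by
  intro u w hw h
  obtain ⟨l, hl, rfl⟩ := reads_iff.1 h
  obtain ⟨x, a, s, b, y, rfl, hba, hs⟩ :=
    exists_cancellation hX hp hl (by rintro rfl; exact hw rfl)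
  refine ⟨x.map fun a => a.base.ohyp, a.base.ohyp, s.map fun a => a.base.ohyp,
    y.map fun a => a.base.ohyp, ?_, ?_⟩
  · have : b.base.ohyp = a.base.ohyp.inv := by
      rw [← LEdge.ohyp_eq_of_cls_eq hba]
      exact (OHyperplane.inv_inv _).symm
    simp only [List.map_append, List.map_cons, this]
    rfl
  · intro k hk
    obtain ⟨c, hc, rfl⟩ := List.mem_map.1 hk
    exact hs c hc

end CubeCpx

namespace CubeCpx

variable {X : Type*} [TopologicalSpace X] [CWComplex (univ : Set X)] {E : Type*}
  [TopologicalSpace E] {p : E → X}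

/-! ## Words and the fundamental group -/

theorem surjective_of_isCoveringMap {Y F : Type*} [TopologicalSpace Y] [TopologicalSpace F]
    [ConnectedSpace Y] [Nonempty F] {q : F → Y} (hq : IsCoveringMap q) :
    Function.Surjective q := by
  rw [← range_eq_univ]
  refine IsClopen.eq_univ ⟨⟨isOpen_iff_forall_mem_open.2 fun y hy => ?_⟩,
    hq.isOpenMap.isOpen_range⟩ (range_nonempty q)
  obtain ⟨-, U, hyU, hU, -, H, hH⟩ := hq y
  refine ⟨U, fun z hz ⟨e, he⟩ => ?_, hU, hyU⟩
  exact hy ⟨_, (H ⟨e, by rw [mem_preimage, he]; exact hz⟩).2.2⟩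

section words

variable (hX : IsSpecial X) (hp : IsCoveringMap p)

/-- Every lift of the path `γ` of `X` is homotopic to a path labelled by the word `w`. -/
def Traces {x y : X} (γ : Path x y) (w : List (OHyperplane X)) : Prop :=
  ∀ e, p e = x → ∃ e', (labelledGraph hX hp).Reads e w e' ∧ ∃ γ' : Path e e', ∀ t, p (γ' t) = γ t

variable {hX hp}

theorem traces_refl (x : X) : Traces hX hp (Path.refl x) [] :=
  fun e he => ⟨e, rfl, Path.refl e, fun _ => he⟩

theorem Traces.trans {x y z : X} {γ : Path x y} {γ' : Path y z} {w w' : List (OHyperplane X)}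
    (h : Traces hX hp γ w) (h' : Traces hX hp γ' w') :
    Traces hX hp (γ.trans γ') (w ++ w') := by
  intro e he
  obtain ⟨e₁, h1, Γ, hΓ⟩ := h e he
  obtain ⟨e₂, h2, Γ', hΓ'⟩ := h' e₁ (by simpa using hΓ 1)
  refine ⟨e₂, LabelledGraph.reads_append.2 ⟨e₁, h1, h2⟩, Γ.trans Γ', fun t => ?_⟩
  rw [Path.trans_apply, Path.trans_apply]
  split_ifs
  · exact hΓ _
  · exact hΓ' _

theorem Traces.symm {x y : X} {γ : Path x y} {w : List (OHyperplane X)}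
    (h : Traces hX hp γ w) : Traces hX hp γ.symm (w.reverse.map OHyperplane.inv) := by
  intro e he
  obtain ⟨Γ, hΓ, hΓ0⟩ := hp.exists_path_lifts γ.symm.toContinuousMap e (by simp [he])
  have hΓt : ∀ t, p (Γ t) = γ.symm t := congrFun hΓ
  obtain ⟨e', h1, γ', hγ'⟩ := h (Γ 1) (by rw [hΓt]; simp)
  let Γ' : Path e (Γ 1) := ⟨Γ, hΓ0, rfl⟩
  have h2 : (γ' : unitInterval → E) = Γ'.symm := by
    refine hp.eq_of_comp_eq γ'.continuous Γ'.symm.continuous (funext fun t => ?_) 0 (by simp)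
    have : p (Γ'.symm t) = γ.symm (unitInterval.symm t) := hΓt _
    rw [Function.comp_apply, Function.comp_apply, hγ', this]
    simp
  have h3 : e' = e := by
    have := congrFun h2 1
    simpa using this
  subst h3
  exact ⟨Γ 1, LabelledGraph.reads_inv h1, Γ', hΓt⟩

/-- An edge of `X` lifts at every preimage of its origin, so the projection of a single path traces
the word from every lift of its starting point. -/
theorem LabelledGraph.Reads.exists_traces {e e' : E} {w : List (OHyperplane X)}
    (h : (labelledGraph hX hp).Reads e w e') :
    ∃ γ : Path (p e) (p e'), Traces hX hp γ w := by
  induction w generalizing e with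
  | nil =>
    obtain rfl : e = e' := h
    exact ⟨Path.refl _, traces_refl _⟩
  | cons J w ih =>
    obtain ⟨_, ⟨a, rfl, rfl, rfl⟩, h⟩ := h
    obtain ⟨γ, hγ⟩ := ih h
    refine ⟨(a.path.map hp.continuous).trans γ, Traces.trans (w := [a.base.ohyp]) ?_ hγ⟩
    intro e he
    obtain ⟨b, hb, rfl⟩ := LEdge.exists_org hp a.base e (by rw [he, a.p_org])
    refine ⟨b.ter, ⟨_, ⟨b, rfl, rfl, by rw [hb]⟩, rfl⟩, b.path, fun t => ?_⟩
    rw [Path.map_coe, Function.comp_apply, LEdge.path_apply, LEdge.path_apply, a.lift, b.lift, hb]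

variable (hX hp) in
/-- The element `g` of the fundamental group is represented by the word `w`. -/
def Represents {x : X} (g : FundamentalGroup X x) (w : List (OHyperplane X)) : Prop :=
  ∃ γ : Path x x, FundamentalGroup.fromPath (Path.Homotopic.Quotient.mk γ) = g ∧ Traces hX hp γ w

namespace Represents

variable {x : X} {g g' : FundamentalGroup X x} {w w' : List (OHyperplane X)}

theorem one : Represents hX hp (1 : FundamentalGroup X x) [] :=
  ⟨Path.refl x, rfl, traces_refl x⟩

/-- In a product, the path of the second factor is run first; hence the order of the words. -/
theorem mul (h : Represents hX hp g w) (h' : Represents hX hp g' w') :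
    Represents hX hp (g * g') (w' ++ w) := by
  obtain ⟨γ, rfl, h⟩ := h
  obtain ⟨γ', rfl, h'⟩ := h'
  exact ⟨γ'.trans γ, rfl, h'.trans h⟩

theorem inv (h : Represents hX hp g w) :
    Represents hX hp g⁻¹ (w.reverse.map OHyperplane.inv) := by
  obtain ⟨γ, rfl, h⟩ := h
  exact ⟨γ.symm, rfl, h.symm⟩

theorem pow (h : Represents hX hp g w) (m : ℕ) :
    Represents hX hp (g ^ m) (LabelledGraph.wpow w m) := by
  induction m with
  | zero => rw [pow_zero]; exact one
  | succ m ih => rw [pow_succ, LabelledGraph.wpow_succ]; exact ih.mul h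

theorem exists_zpow (h : Represents hX hp g w) (m : ℤ) : ∃ w', Represents hX hp (g ^ m) w' ∧
    ∀ J ∈ w', ∃ H ∈ w, J.hyp = H.hyp := by
  obtain ⟨k, rfl | rfl⟩ := m.eq_nat_or_neg
  · refine ⟨_, by rw [zpow_natCast]; exact h.pow k, fun J hJ => ?_⟩
    exact ⟨J, LabelledGraph.mem_of_mem_wpow hJ, rfl⟩
  · refine ⟨_, by rw [zpow_neg, zpow_natCast]; exact (h.pow k).inv, fun J hJ => ?_⟩
    obtain ⟨H, hH, rfl⟩ := List.mem_map.1 hJ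
    exact ⟨H, LabelledGraph.mem_of_mem_wpow (List.mem_reverse.1 hH), H.inv_hyp⟩

theorem exists_reads (h : Represents hX hp g w) {e : E} (he : p e = x) :
    ∃ e', (labelledGraph hX hp).Reads e w e' ∧ p e' = x := by
  obtain ⟨γ, rfl, h⟩ := h
  obtain ⟨e', h1, Γ, hΓ⟩ := h e he
  exact ⟨e', h1, by simpa using hΓ 1⟩

/-- A null-homotopic loop lifts to closed paths. -/
theorem reads_of_one (h : Represents hX hp (1 : FundamentalGroup X x) w) {e : E} (he : p e = x) :
    (labelledGraph hX hp).Reads e w e := by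
  obtain ⟨γ, h1, h⟩ := h
  obtain ⟨e', h2, Γ, hΓ⟩ := h e he
  have h3 : γ.Homotopic (Path.refl x) := Path.Homotopic.Quotient.exact h1
  have h4 := hp.liftPath_apply_one_eq_of_homotopicRel h3 e (by simp [he]) (by simp [he])
  have h5 := (hp.eq_liftPath_iff' (γ := γ.toContinuousMap) (e := e) (by simp [he])
    (Γ := Γ.toContinuousMap)).2 ⟨funext fun t => hΓ t, Γ.source⟩
  have h6 := (hp.eq_liftPath_iff' (γ := (Path.refl x).toContinuousMap) (e := e) (by simp [he])
    (Γ := (Path.refl e).toContinuousMap)).2 ⟨funext fun t => he, rfl⟩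
  rw [← h5, ← h6] at h4
  have h7 : Γ 1 = Path.refl e 1 := h4
  have h8 : e' = e := by simpa using h7
  rwa [h8] at h2

/-- Two lifts with the same ends are homotopic in the simply connected `E`, and the homotopy
projects to `X`. -/
theorem unique [SimplyConnectedSpace E] (h : Represents hX hp g w) (h' : Represents hX hp g' w')
    {e e' : E} (he : p e = x) (hw : (labelledGraph hX hp).Reads e w e')
    (hw' : (labelledGraph hX hp).Reads e w' e') : g = g' := by
  obtain ⟨γ, rfl, h⟩ := h
  obtain ⟨γ', rfl, h'⟩ := h'
  obtain ⟨e₁, h1, Γ, hΓ⟩ := h e he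
  obtain ⟨e₂, h2, Γ', hΓ'⟩ := h' e he
  obtain rfl := LabelledGraph.reads_unique h1 hw
  obtain rfl := LabelledGraph.reads_unique h2 hw'
  have he₂ : p e₂ = x := by simpa using hΓ 1
  have h3 := (SimplyConnectedSpace.paths_homotopic Γ Γ').map ⟨p, hp.continuous⟩
  have h4 : γ = (Γ.map hp.continuous).cast he.symm he₂.symm := by
    ext t; exact (hΓ t).symm
  have h5 : γ' = (Γ'.map hp.continuous).cast he.symm he₂.symm := by
    ext t; exact (hΓ' t).symm
  have h6 : γ.Homotopic γ' := by
    rw [h4, h5]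
    exact h3.pathCast he.symm he₂.symm
  exact congrArg FundamentalGroup.fromPath (Path.Homotopic.Quotient.eq.2 h6)

/-- The blocks appear in reverse order, but this is harmless: filtering by `P i` keeps exactly the
block of index `i`. -/
theorem list_prod {n : ℕ} {k : Fin n → FundamentalGroup X x} {u : Fin n → List (OHyperplane X)}
    (hu : ∀ i, Represents hX hp (k i) (u i)) (P : Fin n → OHyperplane X → Bool)
    (hP : ∀ i j, ∀ J ∈ u j, P i J = decide (i = j)) (l : List (Fin n)) (hl : l.Nodup) :
    ∃ W, Represents hX hp (l.map k).prod W ∧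
      ∀ i, W.filter (P i) = if i ∈ l then u i else [] := by
  induction l with
  | nil => exact ⟨[], one, by simp⟩
  | cons j l ih =>
    rw [List.nodup_cons] at hl
    obtain ⟨W, h1, h2⟩ := ih hl.2
    refine ⟨W ++ u j, (hu j).mul h1, fun i => ?_⟩
    rw [List.filter_append, h2]
    by_cases hij : i = j
    · subst hij
      rw [if_neg hl.1, if_pos List.mem_cons_self, List.nil_append, List.filter_eq_self]
      intro J hJ
      simp [hP i i J hJ]
    · have h3 : (u j).filter (P i) = [] := by
        rw [List.filter_eq_nil_iff]
        intro J hJ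
        simp [hP i j J hJ, hij]
      rw [h3, List.append_nil]
      simp [hij]

end Represents

/-! ### Free abelian subgroups from transverse words -/

/-- Closed paths in `X`, labelled by pairwise transverse words, which do not lift to closed paths,
generate a free abelian group. -/
theorem exists_subgroup_of_reads [T2Space X] [CompactSpace X] [SimplyConnectedSpace E] {n : ℕ}
    (e : E) (w : Fin n → List (OHyperplane X)) (e' : Fin n → E)
    (hw : ∀ i, (labelledGraph hX hp).Reads e (w i) (e' i)) (he : ∀ i, p (e' i) = p e)
    (hne : ∀ i, e' i ≠ e)
    (hT : ∀ i j, i ≠ j → ∀ J ∈ w i, ∀ H ∈ w j, Transverse J.hyp H.hyp) :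
    ∃ H : Subgroup (FundamentalGroup X (p e)), Nonempty (H ≃* Multiplicative (Fin n → ℤ)) := by
  classical
  let G := labelledGraph hX hp
  have hG : G.Coherent := coherent_labelledGraph hX hp
  have hg : ∀ i, ∃ g : FundamentalGroup X (p e), Represents hX hp g (w i) := fun i => by
    obtain ⟨γ, hγ⟩ := (hw i).exists_traces
    refine ⟨_, γ.cast rfl (he i).symm, rfl, fun e₀ h₀ => ?_⟩
    exact hγ e₀ h₀
  choose g hg using hg
  have hcomm : ∀ i j, i ≠ j → Commute (g i) (g j) := fun i j hij => by
    have h1 := (hg i).mul (hg j)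
    have h2 := (hg j).mul (hg i)
    obtain ⟨e₁, h3, -⟩ := h1.exists_reads rfl
    -- The letters of the two words can be exchanged, so both products lead from the base vertex to
    -- the same endpoint.
    exact h1.unique h2 rfl h3
      (h3.reds (LabelledGraph.reds_comm fun a ha b hb => hT j i hij.symm a ha b hb))
  let φ : (Fin n → Multiplicative ℤ) →* FundamentalGroup X (p e) :=
    MonoidHom.noncommPiCoprod (fun i => zpowersHom _ (g i)) fun i j hij a b => by
      simpa using ((hcomm i j hij).zpow_zpow _ _)
  have hφ : ∀ m, φ m = ((List.finRange n).map fun i => g i ^ (m i).toAdd).prod := fun m => by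
    rw [← Finset.noncommProd_toFinset (List.finRange n) (fun i => g i ^ (m i).toAdd)
      (fun i _ j _ hij => (hcomm i j hij).zpow_zpow _ _) (List.nodup_finRange n)]
    simp only [List.toFinset_finRange]
    rfl
  have hinj : Function.Injective φ := by
    rw [injective_iff_map_eq_one]
    intro m hm
    by_contra hcon
    obtain ⟨i, hi⟩ : ∃ i, m i ≠ 1 := by
      by_contra h
      push Not at h
      exact hcon (funext h)
    choose u hu hu' using fun i => (hg i).exists_zpow (m i).toAdd
    -- `P i` recognizes the hyperplanes of `w i`. No hyperplane occurs in two of the words, as it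
    -- would be transverse to itself.
    let P : Fin n → OHyperplane X → Bool := fun i J => decide (∃ H ∈ w i, J.hyp = H.hyp)
    have hP : ∀ i j, ∀ J ∈ u j, P i J = decide (i = j) := by
      intro i j J hJ
      obtain ⟨H, hH, hJH⟩ := hu' j J hJ
      by_cases hij : i = j
      · subst hij
        have : ∃ H ∈ w i, J.hyp = H.hyp := ⟨H, hH, hJH⟩
        simp [P, this]
      · have : ¬ ∃ H ∈ w i, J.hyp = H.hyp := by
          rintro ⟨K, hK, hJK⟩
          have := hT i j hij K hK H hH
          rw [← hJK, ← hJH] at this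
          exact hX.not_transverse_self _ this
        simp only [P, this, hij]
    obtain ⟨W, hW, hWP⟩ := Represents.list_prod hu P hP (List.finRange n) (List.nodup_finRange n)
    rw [← hφ, hm] at hW
    -- The word of a trivial product reduces to the empty one; erasing the letters foreign to `i`
    -- leaves a reduction of `u i` to the empty word, so a nontrivial power of `g i` is trivial.
    have h1 : G.Reds W [] := hG.reds_nil (hW.reads_of_one rfl)
    have h2 := h1.filter (P i) fun J => by
      simp only [P]
      congr 1
      simp only [G, labelledGraph, OHyperplane.inv_hyp]
    rw [hWP, if_pos (List.mem_finRange i), List.filter_nil] at h2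
    obtain ⟨e₁, h3, -⟩ := (hu i).exists_reads rfl
    have h4 : e = e₁ := h3.reds h2
    have h5 : g i ^ (m i).toAdd = 1 :=
      (hu i).unique Represents.one rfl h3 h4
    have h6 : g i ^ (m i).toAdd.natAbs = 1 := by
      rcases Int.natAbs_eq (m i).toAdd with h | h
      · rw [h, zpow_natCast] at h5; exact h5
      · rw [h, zpow_neg, zpow_natCast, inv_eq_one] at h5; exact h5
    have h7 := (hg i).pow (m i).toAdd.natAbs
    rw [h6] at h7
    have h8 := hG.reads_of_reads_wpow (by simpa using hi) (h7.reads_of_one rfl)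
    exact hne i (LabelledGraph.reads_unique (hw i) h8)
  refine ⟨φ.range, ⟨(MonoidHom.ofInjective hinj).symm.trans
    (MulEquiv.piMultiplicative fun _ : Fin n => ℤ).symm⟩⟩

end words

end CubeCpx

namespace CubeCpx

/-! ## Combinatorial flats -/

theorem eq_of_step_invariant {ι β : Type*} [Fintype ι] [DecidableEq ι] {F : (ι → ℤ) → β} {i : ι}
    (h : ∀ z j, j ≠ i → F (Function.update z j (z j + 1)) = F z) {z z' : ι → ℤ}
    (hz : z i = z' i) : F z = F z' := by
  have h1 : ∀ z j, j ≠ i → ∀ m : ℤ, F (Function.update z j (z j + m)) = F z := by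
    intro z j hj m
    induction m using Int.induction_on with
    | zero => simp
    | succ k ih =>
      have := h (Function.update z j (z j + k)) j hj
      rw [Function.update_idem, Function.update_self, ih] at this
      rw [← this, add_assoc]
    | pred k ih =>
      have := h (Function.update z j (z j + (-k - 1))) j hj
      rw [Function.update_idem, Function.update_self] at this
      rw [← this, show z j + (-(k : ℤ) - 1) + 1 = z j + -k by ring, ih]
  have h2 : ∀ z j, j ≠ i → ∀ a : ℤ, F (Function.update z j a) = F z := by
    intro z j hj a
    have := h1 z j hj (a - z j)
    rwa [add_sub_cancel] at this
  have h3 := eq_of_update_invariant (fun y => F (Function.update y i (z i))) (fun y j a => by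
    by_cases hj : j = i
    · subst hj; rw [Function.update_idem]
    · rw [Function.update_comm hj, h2 _ _ hj]) z z'
  rwa [Function.update_eq_self, hz, Function.update_eq_self] at h3

variable {X : Type*} [TopologicalSpace X] [CWComplex (univ : Set X)] {E : Type*}
  [TopologicalSpace E] {p : E → X} {n : ℕ} {f : (Fin n → ℝ) → E}

namespace IsCombinatorialFlat

/-- An edge of `X` is determined by its origin and its label, because there is no self-osculation.
-/
theorem step_base_eq (hX : IsSpecial X) (hp : IsCoveringMap p) {u u' v v' : E}
    {J : OHyperplane X} (h : (labelledGraph hX hp).Step u J v)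
    (h' : (labelledGraph hX hp).Step u' J v') (hu : p u = p u') : p v = p v' := by
  obtain ⟨a, rfl, rfl, rfl⟩ := h
  obtain ⟨b, rfl, rfl, hJ⟩ := h'
  rw [a.p_org, b.p_org] at hu
  rw [a.p_ter, b.p_ter, hX.eq_of_ohyp_eq hJ.symm hu]

variable (hf : IsCombinatorialFlat p n f)

include hf

/-- The cube of the flat with lower corner `z`. -/
def cube (z : Fin n → ℤ) : C(Fin n → ℝ, E) where
  toFun t := f fun k => (z k : ℝ) + (clampMap n t k + 1) / 2
  continuous_toFun := hf.continuous.comp (continuous_pi fun k => continuous_const.add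
    ((((continuous_apply k).comp (continuous_clampMap n)).add continuous_const).div_const 2))

theorem isLiftedCube_cube (z : Fin n → ℤ) : IsLiftedCube p (hf.cube z) := by
  obtain ⟨c, σ, s, h⟩ := hf.cubes z
  refine ⟨c, σ, s, fun t => (h _ (clampMap_mem t)).trans ?_⟩
  rw [cm_apply, clampMap_cubeIso]

theorem exists_edge (hX : IsCubeComplex X) (z : Fin n → ℤ) (i : Fin n) :
    ∃ a : LEdge p, ∀ t, a.map t = f (Function.update (fun k => (z k : ℝ)) i
      (z i + (clamp (t 0) + 1) / 2)) := by
  obtain ⟨a, ha⟩ := LEdge.exists_map ((hf.isLiftedCube_cube z).face hX (isFaceMap_edge (-1) i))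
  refine ⟨a, fun t => ?_⟩
  rw [ha, comp_mk_apply]
  change f _ = f _
  congr 1
  funext k
  by_cases hk : k = i
  · subst hk; simp [clampMap]
  · simp [hk, clampMap, vertex, sgn_neg_one]

/-- The edge of the flat which starts at `z` in the `i`-th direction. -/
def edge (hX : IsCubeComplex X) (z : Fin n → ℤ) (i : Fin n) : LEdge p :=
  (hf.exists_edge hX z i).choose

theorem edge_map (hX : IsCubeComplex X) (z : Fin n → ℤ) (i : Fin n) (t : Fin 1 → ℝ) :
    (hf.edge hX z i).map t = f (Function.update (fun k => (z k : ℝ)) i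
      (z i + (clamp (t 0) + 1) / 2)) :=
  (hf.exists_edge hX z i).choose_spec t

theorem edge_org (hX : IsCubeComplex X) (z : Fin n → ℤ) (i : Fin n) :
    (hf.edge hX z i).org = f fun k => (z k : ℝ) := by
  rw [LEdge.org, hf.edge_map]
  congr 1
  funext k
  by_cases hk : k = i
  · subst hk; simp
  · simp [hk]

theorem edge_ter (hX : IsCubeComplex X) (z : Fin n → ℤ) (i : Fin n) :
    (hf.edge hX z i).ter = f fun k => (Function.update z i (z i + 1) k : ℤ) := by
  rw [LEdge.ter, hf.edge_map]
  congr 1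
  funext k
  by_cases hk : k = i
  · subst hk; simp
  · simp [hk]

theorem cube_square_apply (z : Fin n → ℤ) {i j : Fin n} (hij : i ≠ j) (t : Fin 2 → ℝ) :
    (hf.cube z).comp ⟨_, (isFaceMap_square (-1) hij).continuous⟩ t =
      f (Function.update (Function.update (fun k => (z k : ℝ)) i (z i + (clamp (t 0) + 1) / 2)) j
        (z j + (clamp (t 1) + 1) / 2)) := by
  rw [comp_mk_apply]
  change f _ = f _
  congr 1
  funext k
  by_cases hk : k = j
  · subst hk; simp [clampMap]
  · by_cases hk' : k = i
    · subst hk'; simp [hk, clampMap]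
    · simp [hk, hk', clampMap, vertex, sgn_neg_one]

theorem spanSquare_edge (hX : IsCubeComplex X) (z : Fin n → ℤ) {i j : Fin n} (hij : i ≠ j) :
    SpanSquare (hf.edge hX z i).base (hf.edge hX z j).base := by
  refine IsCorner.spanSquare (ℓ := (hf.cube z).comp ⟨_, (isFaceMap_square (-1) hij).continuous⟩)
    ((hf.isLiftedCube_cube z).face hX (isFaceMap_square (-1) hij)) ⟨fun t => ?_, fun t => ?_⟩
  · rw [hf.edge_map, hf.cube_square_apply z hij]
    congr 1
    funext k
    by_cases hk : k = j
    · subst hk; simp [hij.symm]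
    · simp [hk]
  · rw [hf.edge_map, hf.cube_square_apply z hij]
    congr 1
    funext k
    by_cases hk : k = i
    · subst hk; simp [hij]
    · by_cases hk' : k = j
      · subst hk'; simp
      · simp [hk']

theorem par_edge (hX : IsCubeComplex X) (z : Fin n → ℤ) {i j : Fin n} (hij : i ≠ j) :
    Par (hf.edge hX z i) (hf.edge hX (Function.update z j (z j + 1)) i) := by
  refine ⟨_, (hf.isLiftedCube_cube z).face hX (isFaceMap_square (-1) hij), fun t => ?_,
    fun t => ?_⟩
  · rw [hf.edge_map, hf.cube_square_apply z hij]
    congr 1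
    funext k
    by_cases hk : k = j
    · subst hk; simp [hij.symm]
    · simp [hk]
  · rw [hf.edge_map, hf.cube_square_apply z hij]
    congr 1
    funext k
    by_cases hk : k = i
    · subst hk; simp [hij]
    · by_cases hk' : k = j
      · subst hk'; simp [hij.symm]
      · simp [hk, hk']

/-- The label of the edges of the flat in the `i`-th direction whose `i`-th coordinate varies from
`k` to `k + 1`. -/
def label (hX : IsCubeComplex X) (i : Fin n) (k : ℤ) : OHyperplane X :=
  (hf.edge hX (fun _ => k) i).base.ohyp

/-- Translating an edge in another direction moves it across a square of the flat, which preserves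
its dual oriented hyperplane. -/
theorem edge_ohyp (hX : IsCubeComplex X) (z : Fin n → ℤ) (i : Fin n) :
    (hf.edge hX z i).base.ohyp = hf.label hX i (z i) :=
  eq_of_step_invariant (F := fun z => (hf.edge hX z i).base.ohyp) (i := i)
    (fun z _ hj => (Quot.sound (hf.par_edge hX z hj.symm).parallelInSquare).symm) rfl

theorem transverse_label (hX : IsCubeComplex X) {i j : Fin n} (hij : i ≠ j) (k l : ℤ) :
    Transverse (hf.label hX i k).hyp (hf.label hX j l).hyp := by
  let z : Fin n → ℤ := Function.update (fun _ => k) j l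
  refine ⟨(hf.edge hX z i).base, (hf.edge hX z j).base, ?_, ?_, hf.spanSquare_edge hX z hij⟩
  · rw [← OEdge.ohyp_hyp, hf.edge_ohyp]; simp [z, hij]
  · rw [← OEdge.ohyp_hyp, hf.edge_ohyp]; simp [z]

/-- The word read in the flat in the `i`-th direction from `k` to `k + N`. -/
def word (hX : IsCubeComplex X) (i : Fin n) (k : ℤ) (N : ℕ) : List (OHyperplane X) :=
  (List.range N).map fun m : ℕ => hf.label hX i (k + m)

theorem step_edge (hX : IsSpecial X) (hp : IsCoveringMap p) (z : Fin n → ℤ) (i : Fin n) :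
    (labelledGraph hX hp).Step (f fun k => (z k : ℝ)) (hf.label hX.isCubeComplex i (z i))
      (f fun k => (Function.update z i (z i + 1) k : ℤ)) :=
  ⟨hf.edge hX.isCubeComplex z i, hf.edge_org _ z i, hf.edge_ter _ z i, hf.edge_ohyp _ z i⟩

theorem reads_word (hX : IsSpecial X) (hp : IsCoveringMap p) (z : Fin n → ℤ) (i : Fin n) (N : ℕ) :
    (labelledGraph hX hp).Reads (f fun k => (z k : ℝ)) (hf.word hX.isCubeComplex i (z i) N)
      (f fun k => (Function.update z i (z i + N) k : ℤ)) := by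
  induction N with
  | zero => simp [word]
  | succ N ih =>
    rw [word, List.range_succ, List.map_append, LabelledGraph.reads_append]
    refine ⟨_, ih, _, ?_, rfl⟩
    have := hf.step_edge hX hp (Function.update z i (z i + N)) i
    rw [Function.update_self, Function.update_idem, add_assoc] at this
    exact_mod_cast this

theorem exists_period [T2Space X] [CompactSpace X] (hX : IsSpecial X) (hp : IsCoveringMap p)
    (i : Fin n) : ∃ (a : ℤ) (N : ℕ), N ≠ 0 ∧ ∀ z : Fin n → ℤ, z i = a →
      p (f fun k => (z k : ℝ)) = p (f fun k => (Function.update z i (z i + N) k : ℤ)) := by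
  have := finite_cells X
  have : Finite (OEdge X) := by
    refine Finite.of_injective
      (fun a : OEdge X => ((⟨1, a.edge⟩, a.dir) : (Σ n, Cube X n) × ℤˣ)) fun a b hab => ?_
    simp only [Prod.mk.injEq, Sigma.mk.injEq, heq_eq_eq, true_and] at hab
    exact OEdge.ext hab.1 hab.2
  let c : ℤ → Fin n → ℤ := fun k => Function.update 0 i k
  -- Pigeonhole on the edges of the `i`-th axis, as `X` has finitely many oriented edges.
  obtain ⟨a, b, hlt, hab⟩ : ∃ a b : ℤ, a < b ∧
      (hf.edge hX.isCubeComplex (c a) i).base = (hf.edge hX.isCubeComplex (c b) i).base := by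
    obtain ⟨a, b, hne, hab⟩ := Finite.exists_ne_map_eq_of_infinite
      fun k => (hf.edge hX.isCubeComplex (c k) i).base
    rcases lt_or_gt_of_ne hne with h | h
    · exact ⟨a, b, h, hab⟩
    · exact ⟨b, a, h, hab.symm⟩
  obtain ⟨N, hN⟩ := Int.eq_ofNat_of_zero_le (sub_nonneg.2 hlt.le)
  obtain rfl : b = a + N := by omega
  refine ⟨a, N, by rintro rfl; simp at hlt, fun z hz => ?_⟩
  let F : (Fin n → ℤ) → Prop := fun z =>
    p (f fun k => (z k : ℝ)) = p (f fun k => (Function.update z i (z i + N) k : ℤ))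
  -- The steps in direction `j` from `z` and from its translate by `N` have the same label, so
  -- coincidence of the projections propagates along them, forwards and backwards. It thus spreads
  -- from the axis to the whole slice.
  have hF : ∀ z j, j ≠ i → F (Function.update z j (z j + 1)) = F z := by
    intro z j hj
    have h1 := hf.step_edge hX hp z j
    have h2 := hf.step_edge hX hp (Function.update z i (z i + N)) j
    rw [Function.update_of_ne hj, Function.update_comm hj.symm] at h2
    simp only [F, Function.update_of_ne hj.symm]
    refine propext ⟨fun h => ?_, fun h => step_base_eq hX hp h1 h2 h⟩
    exact step_base_eq hX hp ((labelledGraph hX hp).step_inv h1)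
      ((labelledGraph hX hp).step_inv h2) h
  have h1 : F (c a) := by
    have h2 := (hf.edge hX.isCubeComplex (c a) i).p_org
    rw [hab, ← LEdge.p_org, edge_org, edge_org] at h2
    simp only [F, c, Function.update_self, Function.update_idem]
    exact h2
  have h3 : F z = F (c a) := eq_of_step_invariant hF (by simp [c, hz])
  exact h3.mpr h1

end IsCombinatorialFlat

end CubeCpx

end

theorem mainTheorem3 {X : Type*} [TopologicalSpace X] [T2Space X] [CompactSpace X]
    [ConnectedSpace X] [Topology.CWComplex (Set.univ : Set X)] (hX : CubeCpx.IsSpecial X)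
    {E : Type*} [TopologicalSpace E] [SimplyConnectedSpace E] (p : E → X) (hp : IsCoveringMap p)
    (n : ℕ) (hn : 1 ≤ n) (f : (Fin n → ℝ) → E) (hf : CubeCpx.IsCombinatorialFlat p n f) (x : X) :
    ∃ H : Subgroup (FundamentalGroup X x), Nonempty (H ≃* Multiplicative (Fin n → ℤ)) := by
  -- The vertex with coordinates `a i` lies in the slices of all the directions, so all `n` periods
  -- start there.
  choose a N hN hper using hf.exists_period hX hp
  obtain ⟨H, ⟨ψ⟩⟩ := CubeCpx.exists_subgroup_of_reads (hX := hX) (hp := hp) (f fun k => (a k : ℝ))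
    (fun i => hf.word hX.isCubeComplex i (a i) (N i)) _
    (fun i => hf.reads_word hX hp a i (N i)) (fun i => (hper i a rfl).symm)
    (fun i h => by
      have h1 := congrFun (hf.injective h) i
      simp [hN i] at h1)
    (fun i j hij J hJ K hK => by
      obtain ⟨k, -, rfl⟩ := List.mem_map.1 hJ
      obtain ⟨l, -, rfl⟩ := List.mem_map.1 hK
      exact hf.transverse_label hX.isCubeComplex hij _ _)
  -- The subgroup was found at the image of a vertex of the flat; a change of basepoint brings it to
  -- `x`.
  have : PathConnectedSpace X :=
    (CubeCpx.surjective_of_isCoveringMap hp).pathConnectedSpace hp.continuous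
  let e := FundamentalGroup.fundamentalGroupMulEquivOfPathConnected (p (f fun k => (a k : ℝ))) x
  exact ⟨H.map e.toMonoidHom, ⟨(e.subgroupMap H).symm.trans ψ⟩⟩
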